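/- Let $(\Omega,\mathcal F,\mathbb P)$ be a probability space. A diffusion on $\mathbb R^d$ is a family $(X^x)_{x\in\mathbb R^d}$ of time-homogeneous Markov processes with almost surely continuous paths, $X^x_0=x$ a.s., and with common transition kernels. Its semigroup is $P^X_t\varphi(x)=\mathbb E\,\varphi(X^x_t)$ for $\varphi$ bounded and measurable. Its generator $\mathcal L_X$ is $\mathcal L_X\varphi=\lim_{t\downarrow0}(P^X_t\varphi-\varphi)/t$, where $D(\mathcal L_X)$ is the set of bounded measurable $\varphi$ for which the limit exists uniformly. Put $D(\mathcal L_X^0)=\{\varphi \text{ bounded measurable}:\|P^X_t\varphi-\varphi\|_\infty\to0 \text{ as } t\downarrow 0\}$ and $D(\mathcal L_X^{n})=\{\varphi\in D(\mathcal L_X^{n-1}):\mathcal L_X^{n-1}\varphi\in D(\mathcal L_X)\}$ for $n\ge1$. **Intertwining.** Let $X$ and $U$ be diffusions on $\mathbb R^d$ and $\mathbb R^n$ which are intertwining: there is a measurable $\Lambda\ge0$ on $\mathbb R^n\times\mathbb R^d$ with $\int\Lambda(z,x)\,dx=1$ for every $z$, such that $L\varphi(z)=\int_{\mathbb R^d}\Lambda(z,x)\varphi(x)\,dx$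 satisfies $P^U_tL=LP^X_t$ on bounded measurable functions for all $t>0$. **Time process.** Let $Y=(Y_t)_{t\ge0}$ be a real-valued process with $Y_0=0$ a.s., independent of $X^x$ for every $x\in\mathbb R^d$ and of $U^x$ for every $x\in\mathbb R^n$. Let $p,q\ge0$ and $r\ge1$ be integers and let $\alpha_k,\beta_{i,j}$ be real functions of $t>0$. Assume: 1. for every $t>0$, $Y_t$ has a density $p_Y(t,\cdot)$; 2. for every $t>0$, $p_Y(t,\cdot)\in C^r(\mathbb R)$, and for $i\le q$, $j\le r$ the derivatives $\partial_t^i\partial_u^jp_Y$ exist on $(0,\infty)\times\mathbb R$ with $\partial_t^i\partial_u^jp_Y(t,\cdot)\in L^1(\mathbb R)$ for all $t>0$; 3. the even part $\mathcal E(t,u)=\frac12\big(p_Y(t,u)+p_Y(t,-u)\big)$ has time derivatives up to order $p$ and satisfies, for all $t>0$ and $u\in\mathbb R$, $$\sum_{k=1}^p\alpha_k(t)\,\partial_t^k\mathcal E(t,u)=\sum_{i=0}^q\sum_{j=1}^r\beta_{i,j}(t)\,\partial_t^i\partial_u^j\mathcal E(t,u);$$ 4. these time derivatives are also derivatives in $L^1(du)$: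 for $(i,j)$ with $i<p$, $j=0$, or with $i<q$, $j\le r$, and every $t>0$, the quotient $\big(\partial_t^i\partial_u^j\mathcal E(s,\cdot)-\partial_t^i\partial_u^j\mathcal E(t,\cdot)\big)/(s-t)$ converges to $\partial_t^{i+1}\partial_u^j\mathcal E(t,\cdot)$ in $L^1(\mathbb R)$ as $s\to t$. **Conclusion.** Let $f\in D(\mathcal L_X^{r-1})$, $g=Lf$ and $h(t,x)=\mathbb E\,g\big(U^x_{|Y_t|}\big)$. Then $h(t,\cdot)\in D(\mathcal L_U^{r-1})$ for all $t\ge0$, and $h(t,\cdot)\in D(\mathcal L_U^{r})$ for all $t>0$. For every $x\in\mathbb R^n$ the derivatives $\partial_t^kh(t,x)$ ($k\le p$) and $\partial_t^i\mathcal L_U^jh(t,x)$ ($i\le q$, $j\le r$) exist for $t>0$. On $(0,\infty)\times\mathbb R^n$, $$\sum_{k=1}^p\alpha_k(t)\,\partial_t^kh(t,x)=\sum_{i=0}^q\sum_{j=1}^r(-1)^j\beta_{i,j}(t)\,\partial_t^i\mathcal L_U^jh(t,x)+\mathcal B_g(t,x),$$ where $$\mathcal B_g(t,x)=2\sum_{i=0}^q\sum_{j=1}^r\beta_{i,j}(t)\sum_{0\le2k\le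 j-1}(-1)^{j-2k}\,\mathcal L_U^{j-1-2k}g(x)\;\partial_t^i\partial_u^{2k}p_Y(t,u)\Big|_{u=0}.$$ Moreover $h(0,\cdot)=g$. -/

import Mathlib

open MeasureTheory ProbabilityTheory Filter Topology
open scoped NNReal ENNReal

noncomputable section

namespace IteratedProcess

/-- A diffusion started from every point `x` of `E`, realised on one probability space: the family
of processes `X x = (X^x_t)_{t ≥ 0}` is time-homogeneous Markov (with respect to the natural
filtration of `X^x`, the transition probabilities `κ t` being Markov kernels on `E`) and has
almost surely continuous paths. -/
def IsDiffusion {Ω E : Type*} [MeasurableSpace Ω] [TopologicalSpace E] [MeasurableSpace E]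
    (μ : Measure Ω) (X : E → ℝ≥0 → Ω → E) : Prop :=
  (∀ x t, Measurable (X x t)) ∧
  (∀ x, ∀ᵐ ω ∂μ, X x 0 ω = x) ∧
  (∀ x, ∀ᵐ ω ∂μ, Continuous fun t => X x t ω) ∧
  ∃ κ : ℝ≥0 → Kernel E E, (∀ t, IsMarkovKernel (κ t)) ∧
    ∀ x s t, ∀ A : Set E, MeasurableSet A →
      μ[(X x (s + t) ⁻¹' A).indicator (fun _ => (1 : ℝ)) |
          ⨆ τ ∈ Set.Iic s, MeasurableSpace.comap (X x τ) inferInstance]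
        =ᵐ[μ] fun ω => (κ t (X x s ω)).real A

/-- The semigroup `P_t φ (x) = 𝔼 φ(X^x_t)`. -/
def semigroup {Ω E : Type*} [MeasurableSpace Ω] (μ : Measure Ω) (X : E → ℝ≥0 → Ω → E)
    (t : ℝ≥0) (φ : E → ℝ) (x : E) : ℝ :=
  ∫ ω, φ (X x t ω) ∂μ

/-- Bounded measurable functions. -/
def boundedFunctions (E : Type*) [MeasurableSpace E] : Set (E → ℝ) :=
  {φ | Measurable φ ∧ ∃ C, ∀ x, |φ x| ≤ C}

/-- The space `B₀` of bounded functions `φ` with `‖P_t φ - φ‖_∞ → 0` as `t ↓ 0`. -/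
def strongSpace {E : Type*} [MeasurableSpace E] (P : ℝ≥0 → (E → ℝ) → E → ℝ) : Set (E → ℝ) :=
  {φ ∈ boundedFunctions E | TendstoUniformly (fun t => P t φ) φ (𝓝[>] 0)}

/-- The domain of the infinitesimal generator: the bounded `φ` for which `(P_t φ - φ) / t`
converges in the sup norm as `t ↓ 0`. -/
def generatorDomain {E : Type*} [MeasurableSpace E] (P : ℝ≥0 → (E → ℝ) → E → ℝ) :
    Set (E → ℝ) :=
  {φ ∈ boundedFunctions E |
    ∃ w : E → ℝ, TendstoUniformly (fun (t : ℝ≥0) x => (P t φ x - φ x) / (t : ℝ)) w (𝓝[>] 0)}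

/-- The infinitesimal generator `𝓛 φ = lim_{t ↓ 0} (P_t φ - φ) / t` (meaningful on
`generatorDomain P`, where the limit exists uniformly). -/
def generator {E : Type*} (P : ℝ≥0 → (E → ℝ) → E → ℝ) (φ : E → ℝ) : E → ℝ :=
  fun x => limUnder (𝓝[>] (0 : ℝ≥0)) fun t => (P t φ x - φ x) / (t : ℝ)

/-- `D(𝓛⁰) = B₀` and `D(𝓛ⁿ⁺¹) = {φ ∈ D(𝓛ⁿ) : 𝓛ⁿ φ ∈ D(𝓛)}`. -/
def iterDomain {E : Type*} [MeasurableSpace E] (P : ℝ≥0 → (E → ℝ) → E → ℝ) :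
    ℕ → Set (E → ℝ)
  | 0 => strongSpace P
  | n + 1 => {φ ∈ iterDomain P n | (generator P)^[n] φ ∈ generatorDomain P}

/-- `∂_t^i ∂_u^j F (t, u)` (first `j` derivatives in `u`, then `i` in `t`). -/
def mixedDeriv (i j : ℕ) (F : ℝ → ℝ → ℝ) (t u : ℝ) : ℝ :=
  iteratedDeriv i (fun s => iteratedDeriv j (F s) u) t

/-- The even part in `u`. -/
def evenPart (F : ℝ → ℝ → ℝ) (t u : ℝ) : ℝ := (F t u + F t (-u)) / 2

/-- The assumptions on the time process `Y`: it starts from `0`, has for every `t > 0` the density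
`p t`, regular enough, and the even part of `p` satisfies the equation
`∑ₖ αₖ ∂_t^k E(p) = ∑ᵢ ∑ⱼ β_{i,j} ∂_t^i ∂_u^j E(p)`. -/
structure TimeProcess {Ω : Type*} [MeasurableSpace Ω] (μ : Measure Ω) (Y : ℝ≥0 → Ω → ℝ)
    (p : ℝ → ℝ → ℝ) (m q r : ℕ) (α : ℕ → ℝ → ℝ) (β : ℕ → ℕ → ℝ → ℝ) : Prop where
  measurable : ∀ t, Measurable (Y t)
  start : ∀ᵐ ω ∂μ, Y 0 ω = 0
  nonneg : ∀ t > 0, ∀ u, 0 ≤ p t u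
  density : ∀ t > 0,
    μ.map (Y (Real.toNNReal t)) = volume.withDensity fun u => ENNReal.ofReal (p t u)
  contDiff : ∀ t > 0, ContDiff ℝ r (p t)
  /-- The derivatives `∂_t^i ∂_u^j p`, `i ≤ q`, `j ≤ r`, exist. -/
  differentiable : ∀ i < q, ∀ j ≤ r, ∀ t > 0, ∀ u,
    DifferentiableAt ℝ (fun s => mixedDeriv i j p s u) t
  integrable : ∀ i ≤ q, ∀ j ≤ r, ∀ t > 0, Integrable (mixedDeriv i j p t)
  /-- The derivatives `∂_t^k E(p)`, `k ≤ m`, exist. -/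
  differentiable_even : ∀ k < m, ∀ t > 0, ∀ u,
    DifferentiableAt ℝ (fun s => mixedDeriv k 0 (evenPart p) s u) t
  /-- The time derivatives of the even part that occur in the equation are also derivatives
  in the sense of `L¹(du)`. -/
  deriv_L1 : ∀ i j, (i < m ∧ j = 0) ∨ (i < q ∧ j ≤ r) → ∀ t > 0,
    Tendsto (fun s => ∫⁻ u, ‖(mixedDeriv i j (evenPart p) s u - mixedDeriv i j (evenPart p) t u)
        / (s - t) - mixedDeriv (i + 1) j (evenPart p) t u‖ₑ) (𝓝[≠] t) (𝓝 0)
  equation : ∀ t > 0, ∀ u,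
    ∑ k ∈ Finset.Icc 1 m, α k t * mixedDeriv k 0 (evenPart p) t u =
      ∑ i ∈ Finset.range (q + 1), ∑ j ∈ Finset.Icc 1 r,
        β i j t * mixedDeriv i j (evenPart p) t u

/-- `Λ(z, ·)` is, measurably in `z`, a probability density. -/
def IsDensityKernel {E F : Type*} [MeasurableSpace E] [MeasureSpace F] (Λ : E → F → ℝ) : Prop :=
  Measurable (Function.uncurry Λ) ∧ (∀ z x, 0 ≤ Λ z x) ∧
    ∀ z, ∫⁻ x, ENNReal.ofReal (Λ z x) = 1

/-- `L φ (z) = ∫ Λ(z, x) φ(x) dx`. -/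
def kernelOp {E F : Type*} [MeasureSpace F] (Λ : E → F → ℝ) (φ : F → ℝ) (z : E) : ℝ :=
  ∫ x, Λ z x * φ x

/-- The semigroups `PX` and `PU` are intertwined by the density `Λ`: `PU_t L = L PX_t`, `t > 0`,
as operators on bounded functions. -/
def IsIntertwining {E F : Type*} [MeasurableSpace E] [MeasureSpace F]
    (PX : ℝ≥0 → (F → ℝ) → F → ℝ) (PU : ℝ≥0 → (E → ℝ) → E → ℝ) (Λ : E → F → ℝ) : Prop :=
  IsDensityKernel Λ ∧ ∀ t > 0, ∀ φ ∈ boundedFunctions F,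
    PU t (kernelOp Λ φ) = kernelOp Λ (PX t φ)

/-- `(t, x) ↦ 𝔼 φ(X^x(|Y_t|))`, for `t ≥ 0`. -/
def iteratedMean {Ω E : Type*} [MeasurableSpace Ω] (μ : Measure Ω) (X : E → ℝ≥0 → Ω → E)
    (Y : ℝ≥0 → Ω → ℝ) (φ : E → ℝ) (t : ℝ) (x : E) : ℝ :=
  ∫ ω, φ (X x (Real.nnabs (Y (Real.toNNReal t) ω)) ω) ∂μ

/-- The boundary term
`2 ∑ᵢ ∑ⱼ β_{i,j}(t) ∑_{0 ≤ 2k ≤ j-1} (-1)^{j-2k} A^{j-1-2k} φ(x) ∂_t^i ∂_u^{2k} p(t, 0)`. -/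
def boundaryTerm {E : Type*} (A : (E → ℝ) → E → ℝ) (p : ℝ → ℝ → ℝ) (q r : ℕ)
    (β : ℕ → ℕ → ℝ → ℝ) (φ : E → ℝ) (t : ℝ) (x : E) : ℝ :=
  2 * ∑ i ∈ Finset.range (q + 1), ∑ j ∈ Finset.Icc 1 r, β i j t *
    ∑ k ∈ (Finset.range j).filter (fun k => 2 * k ≤ j - 1),
      (-1) ^ (j - 2 * k) * A^[j - 1 - 2 * k] φ x * mixedDeriv i (2 * k) p t 0

end IteratedProcess

end

open IteratedProcess

/-!
Conditioning on `|Y_t|`, which is independent of `U`, gives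
`h(t, ·) = 2 ∫₀^∞ P_u g · E(p)(t, u) du`, so `h` is a potential of `g` whose weight is the even part
of the density. On such potentials the generator acts by integration by parts in `u`: each power
moves one derivative onto the weight, up to a sign, and leaves a boundary contribution, so that
`𝓛^j h = 2 (-1)^j ∫₀^∞ P_u g · ∂_u^j E(p) du - 2 ∑_{l < j} (-1)^l ∂_u^l E(p)(t, 0) 𝓛^{j-1-l} g`.
Only even `l` survive, because the odd derivatives of an even function vanish at `0`.
Differentiation in `t` passes under the integral since `u ↦ P_u g` is bounded and the time
derivatives of the weight are derivatives in `L¹`; integrating the equation for `E(p)` against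
`P_u g` then yields the equation for `h`. Since `L` is a contraction intertwining the semigroups, it
maps `D(𝓛_X^{r-1})` into `D(𝓛_U^{r-1})`, which is all that the argument needs of `g`.
-/

noncomputable section

namespace IteratedProcess

section BoundedFunctions

variable {E : Type*} [MeasurableSpace E]

/-- The bounded measurable functions as a linear subspace, which supplies their closure under
linear combinations. -/
def boundedSubmodule (E : Type*) [MeasurableSpace E] : Submodule ℝ (E → ℝ) where
  carrier := boundedFunctions E
  zero_mem' := ⟨measurable_zero, 0, by simp⟩
  add_mem' := by
    rintro φ ψ ⟨hφm, C, hC⟩ ⟨hψm, D, hD⟩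
    exact ⟨hφm.add hψm, C + D, fun x => (abs_add_le _ _).trans (add_le_add (hC x) (hD x))⟩
  smul_mem' := by
    rintro c φ ⟨hφm, C, hC⟩
    refine ⟨hφm.const_smul c, |c| * C, fun x => ?_⟩
    rw [Pi.smul_apply, smul_eq_mul, abs_mul]
    exact mul_le_mul_of_nonneg_left (hC x) (abs_nonneg c)

theorem integrable_of_mem_boundedFunctions {φ : E → ℝ} (hφ : φ ∈ boundedFunctions E)
    (ν : Measure E) [IsFiniteMeasure ν] : Integrable φ ν := by
  obtain ⟨hφm, C, hC⟩ := hφ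
  exact Integrable.of_bound hφm.aestronglyMeasurable C (ae_of_all _ hC)

theorem mem_boundedFunctions_of_tendstoUniformly {ι : Type*} {l : Filter ι} [l.NeBot]
    [l.IsCountablyGenerated] {F : ι → E → ℝ} {w : E → ℝ} (hF : ∀ i, F i ∈ boundedFunctions E)
    (h : TendstoUniformly F w l) : w ∈ boundedFunctions E := by
  refine ⟨measurable_of_tendsto_metrizable' l (fun i => (hF i).1)
    (tendsto_pi_nhds.2 fun x => h.tendsto_at x), ?_⟩
  obtain ⟨i, hi⟩ := (Metric.tendstoUniformly_iff.1 h 1 one_pos).exists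
  obtain ⟨-, C, hC⟩ := hF i
  refine ⟨1 + C, fun x => ?_⟩
  calc |w x| = |(w x - F i x) + F i x| := by rw [sub_add_cancel]
    _ ≤ |w x - F i x| + |F i x| := abs_add_le _ _
    _ ≤ 1 + C := add_le_add (hi x).le (hC x)

end BoundedFunctions

section TransitionSemigroup

/-- `P` is the semigroup of operators of the Markov transition kernels `κ`. The value of `P t φ`
is prescribed for measurable `φ` only. -/
structure IsTransitionSemigroup {E : Type*} [MeasurableSpace E] (κ : ℝ≥0 → Kernel E E)
    (P : ℝ≥0 → (E → ℝ) → E → ℝ) : Prop where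
  markov : ∀ t, IsMarkovKernel (κ t)
  apply : ∀ t φ x, Measurable φ → P t φ x = ∫ y, φ y ∂(κ t x)
  dirac : ∀ x, κ 0 x = Measure.dirac x
  comp : ∀ s t, κ (s + t) = κ t ∘ₖ κ s

namespace IsTransitionSemigroup

variable {E : Type*} [MeasurableSpace E] {κ : ℝ≥0 → Kernel E E} {P : ℝ≥0 → (E → ℝ) → E → ℝ}
  {φ ψ : E → ℝ}

theorem abs_apply_le (hP : IsTransitionSemigroup κ P) (t : ℝ≥0) (hφ : Measurable φ)
    {C : ℝ} (hC : ∀ x, |φ x| ≤ C) (x : E) : |P t φ x| ≤ C := by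
  have := hP.markov t
  rw [hP.apply t φ x hφ]
  simpa using norm_integral_le_of_norm_le_const (μ := κ t x) (f := φ) (C := C) (ae_of_all _ hC)

theorem apply_mem (hP : IsTransitionSemigroup κ P) (t : ℝ≥0) (hφ : φ ∈ boundedFunctions E) :
    P t φ ∈ boundedFunctions E := by
  have := hP.markov t
  obtain ⟨hφm, C, hC⟩ := hφ
  refine ⟨?_, C, hP.abs_apply_le t hφm hC⟩
  rw [show P t φ = fun x => ∫ y, φ y ∂(κ t x) from funext fun x => hP.apply t φ x hφm]
  exact (hφm.stronglyMeasurable.integral_kernel (κ := κ t)).measurable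

theorem apply_add (hP : IsTransitionSemigroup κ P) (t : ℝ≥0) (hφ : φ ∈ boundedFunctions E)
    (hψ : ψ ∈ boundedFunctions E) : P t (φ + ψ) = P t φ + P t ψ := by
  have := hP.markov t
  funext x
  simp only [Pi.add_apply, hP.apply _ _ _ hφ.1, hP.apply _ _ _ hψ.1,
    hP.apply _ _ _ (hφ.1.add hψ.1)]
  exact integral_add (integrable_of_mem_boundedFunctions hφ _)
    (integrable_of_mem_boundedFunctions hψ _)

theorem apply_const_smul (hP : IsTransitionSemigroup κ P) (t : ℝ≥0) (c : ℝ) (hφ : Measurable φ) :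
    P t (c • φ) = c • P t φ := by
  funext x
  rw [Pi.smul_apply, hP.apply _ _ _ hφ, hP.apply _ _ _ (hφ.const_smul c)]
  exact integral_smul c φ

theorem apply_sub (hP : IsTransitionSemigroup κ P) (t : ℝ≥0) (hφ : φ ∈ boundedFunctions E)
    (hψ : ψ ∈ boundedFunctions E) : P t (φ - ψ) = P t φ - P t ψ := by
  have hneg : (-1 : ℝ) • ψ ∈ boundedFunctions E := (boundedSubmodule E).smul_mem _ hψ
  rw [sub_eq_add_neg φ, ← neg_one_smul ℝ ψ, hP.apply_add t hφ hneg, hP.apply_const_smul t _ hψ.1,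
    neg_one_smul, ← sub_eq_add_neg]

theorem apply_time_zero (hP : IsTransitionSemigroup κ P) (hφ : Measurable φ) : P 0 φ = φ := by
  funext x
  rw [hP.apply _ _ _ hφ, hP.dirac, integral_dirac' _ _ hφ.stronglyMeasurable]

theorem apply_apply (hP : IsTransitionSemigroup κ P) (s t : ℝ≥0) (hφ : φ ∈ boundedFunctions E) :
    P s (P t φ) = P (s + t) φ := by
  have := hP.markov t
  have := hP.markov s
  have := hP.markov (s + t)
  funext x
  rw [hP.apply _ _ _ (hP.apply_mem t hφ).1, hP.apply _ _ _ hφ.1, hP.comp,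
    Kernel.integral_comp (by rw [← hP.comp]; exact integrable_of_mem_boundedFunctions hφ _)]
  exact integral_congr_ae (ae_of_all _ fun y => hP.apply _ _ _ hφ.1)

theorem abs_apply_add_sub_le (hP : IsTransitionSemigroup κ P) (s t : ℝ≥0)
    (hφ : φ ∈ boundedFunctions E) {C : ℝ} (hC : ∀ x, |P t φ x - φ x| ≤ C) (x : E) :
    |P (s + t) φ x - P s φ x| ≤ C := by
  have hPφ := hP.apply_mem t hφ
  rw [← hP.apply_apply s t hφ, ← Pi.sub_apply, ← hP.apply_sub s hPφ hφ]
  exact hP.abs_apply_le s (hPφ.1.sub hφ.1) hC x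

theorem abs_apply_sub_apply_le (hP : IsTransitionSemigroup κ P) (s t : ℝ≥0)
    (hφ : φ ∈ boundedFunctions E) {C : ℝ} (hC : ∀ x, |P (nndist s t) φ x - φ x| ≤ C) (x : E) :
    |P s φ x - P t φ x| ≤ C := by
  wlog hst : s ≤ t generalizing s t
  · rw [abs_sub_comm]
    exact this t s (by rwa [nndist_comm]) (le_of_not_ge hst)
  obtain ⟨v, rfl⟩ := exists_add_of_le hst
  rw [abs_sub_comm]
  refine hP.abs_apply_add_sub_le s v hφ ?_ x
  rwa [show nndist s (s + v) = v by ext; simp [NNReal.dist_eq]] at hC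

end IsTransitionSemigroup

theorem mem_strongSpace_iff {E : Type*} [MeasurableSpace E] {P : ℝ≥0 → (E → ℝ) → E → ℝ}
    {φ : E → ℝ} : φ ∈ strongSpace P ↔ φ ∈ boundedFunctions E ∧
      ∀ ε > 0, ∀ᶠ t in 𝓝[>] (0 : ℝ≥0), ∀ x, |P t φ x - φ x| < ε := by
  simp only [strongSpace, Set.mem_ofPred_eq, Metric.tendstoUniformly_iff, Real.dist_eq,
    abs_sub_comm]

theorem mem_strongSpace_of_abs_sub_le {E F : Type*} [MeasurableSpace E] [MeasurableSpace F]
    {P : ℝ≥0 → (F → ℝ) → F → ℝ} {Q : ℝ≥0 → (E → ℝ) → E → ℝ} {φ : F → ℝ} {ψ : E → ℝ}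
    (hφ : φ ∈ strongSpace P) (hψ : ψ ∈ boundedFunctions E) {K : ℝ} (hK : 0 ≤ K)
    (h : ∀ t > 0, ∀ C, (∀ x, |P t φ x - φ x| ≤ C) → ∀ x, |Q t ψ x - ψ x| ≤ K * C) :
    ψ ∈ strongSpace Q := by
  refine mem_strongSpace_iff.2 ⟨hψ, fun ε hε => ?_⟩
  have hε' : 0 < ε / (K + 1) := by positivity
  filter_upwards [(mem_strongSpace_iff.1 hφ).2 _ hε', self_mem_nhdsWithin] with t ht ht0 x
  calc |Q t ψ x - ψ x| ≤ K * (ε / (K + 1)) := h t ht0 _ (fun x => (ht x).le) x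
    _ < (K + 1) * (ε / (K + 1)) := by gcongr; exact lt_add_one K
    _ = ε := by field_simp

namespace IsTransitionSemigroup

variable {E : Type*} [MeasurableSpace E] {κ : ℝ≥0 → Kernel E E} {P : ℝ≥0 → (E → ℝ) → E → ℝ}
  {φ ψ : E → ℝ}

theorem eventually_abs_apply_sub_lt (hP : IsTransitionSemigroup κ P) (hφ : φ ∈ strongSpace P)
    {ε : ℝ} (hε : 0 < ε) : ∀ᶠ t in 𝓝 (0 : ℝ≥0), ∀ x, |P t φ x - φ x| < ε := by
  filter_upwards [eventually_nhdsWithin_iff.1 ((mem_strongSpace_iff.1 hφ).2 ε hε)] with t ht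
  rcases eq_or_ne t 0 with rfl | ht0
  · simpa [hP.apply_time_zero hφ.1.1] using fun _ : E => hε
  · exact ht (pos_iff_ne_zero.2 ht0)

theorem continuous_apply (hP : IsTransitionSemigroup κ P) (hφ : φ ∈ strongSpace P) (x : E) :
    Continuous fun t => P t φ x := by
  refine continuous_iff_continuousAt.2 fun t => Metric.tendsto_nhds.2 fun ε hε => ?_
  have hdist : Tendsto (fun s => nndist s t) (𝓝 t) (𝓝 0) := by
    simpa using (continuous_id.nndist (continuous_const (y := t))).tendsto t
  filter_upwards [hdist.eventually (hP.eventually_abs_apply_sub_lt hφ (half_pos hε))] with s hs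
  rw [Real.dist_eq]
  exact (hP.abs_apply_sub_apply_le s t hφ.1 (fun x => (hs x).le) x).trans_lt (half_lt_self hε)

theorem continuous_apply_toNNReal (hP : IsTransitionSemigroup κ P) (hφ : φ ∈ strongSpace P)
    (x : E) : Continuous fun u : ℝ => P u.toNNReal φ x :=
  (hP.continuous_apply hφ x).comp continuous_real_toNNReal

theorem add_mem_strongSpace (hP : IsTransitionSemigroup κ P) (hφ : φ ∈ strongSpace P)
    (hψ : ψ ∈ strongSpace P) : φ + ψ ∈ strongSpace P := by
  refine ⟨(boundedSubmodule E).add_mem hφ.1 hψ.1, ?_⟩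
  simp only [hP.apply_add _ hφ.1 hψ.1]
  exact hφ.2.add hψ.2

theorem const_smul_mem_strongSpace (hP : IsTransitionSemigroup κ P) (c : ℝ)
    (hφ : φ ∈ strongSpace P) : c • φ ∈ strongSpace P := by
  refine ⟨(boundedSubmodule E).smul_mem c hφ.1, ?_⟩
  simp only [hP.apply_const_smul _ c hφ.1.1]
  exact (uniformContinuous_const_smul c).comp_tendstoUniformly hφ.2

end IsTransitionSemigroup

end TransitionSemigroup

section Generator

/-- The graph of the infinitesimal generator: `φ` is bounded measurable and `(P_t φ - φ) / t`
converges uniformly to `w` as `t ↓ 0`. -/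
def HasGenerator {E : Type*} [MeasurableSpace E] (P : ℝ≥0 → (E → ℝ) → E → ℝ)
    (φ w : E → ℝ) : Prop :=
  φ ∈ boundedFunctions E ∧
    TendstoUniformly (fun (t : ℝ≥0) x => (P t φ x - φ x) / (t : ℝ)) w (𝓝[>] 0)

namespace HasGenerator

variable {E : Type*} [MeasurableSpace E] {κ : ℝ≥0 → Kernel E E} {P : ℝ≥0 → (E → ℝ) → E → ℝ}
  {φ ψ v w : E → ℝ}

theorem generator_eq (h : HasGenerator P φ w) : generator P φ = w :=
  funext fun x => (h.2.tendsto_at x).limUnder_eq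

theorem mem_generatorDomain (h : HasGenerator P φ w) : φ ∈ generatorDomain P :=
  ⟨h.1, w, h.2⟩

theorem add (hP : IsTransitionSemigroup κ P) (hφ : HasGenerator P φ v)
    (hψ : HasGenerator P ψ w) : HasGenerator P (φ + ψ) (v + w) := by
  refine ⟨(boundedSubmodule E).add_mem hφ.1 hψ.1, ?_⟩
  convert hφ.2.add hψ.2 using 1
  funext t x
  simp only [Pi.add_apply, hP.apply_add t hφ.1 hψ.1]
  ring

theorem const_smul (hP : IsTransitionSemigroup κ P) (c : ℝ) (h : HasGenerator P φ w) :
    HasGenerator P (c • φ) (c • w) := by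
  refine ⟨(boundedSubmodule E).smul_mem c h.1, ?_⟩
  convert (uniformContinuous_const_smul c).comp_tendstoUniformly h.2 using 1
  · funext t x
    simp only [Function.comp_apply, Pi.smul_apply, smul_eq_mul, hP.apply_const_smul t c h.1.1]
    ring
  · rfl

theorem zero (hP : IsTransitionSemigroup κ P) : HasGenerator P 0 0 := by
  refine ⟨(boundedSubmodule E).zero_mem, ?_⟩
  have hP0 : ∀ t, P t 0 = 0 := fun t => by
    simpa using hP.apply_const_smul t 0 (φ := 0) measurable_zero
  refine Metric.tendstoUniformly_iff.2 fun ε hε => Eventually.of_forall fun t x => ?_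
  simpa [hP0] using hε

theorem sum (hP : IsTransitionSemigroup κ P) {ι : Type*} {s : Finset ι} {φ w : ι → E → ℝ}
    (h : ∀ i ∈ s, HasGenerator P (φ i) (w i)) :
    HasGenerator P (∑ i ∈ s, φ i) (∑ i ∈ s, w i) := by
  classical
  induction s using Finset.induction_on with
  | empty => exact zero hP
  | insert a s ha ih =>
    rw [Finset.sum_insert ha, Finset.sum_insert ha]
    exact add hP (h a (Finset.mem_insert_self a s))
      (ih fun i hi => h i (Finset.mem_insert_of_mem hi))

theorem mem_boundedFunctions (hP : IsTransitionSemigroup κ P) (h : HasGenerator P φ w) :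
    w ∈ boundedFunctions E := by
  refine mem_boundedFunctions_of_tendstoUniformly (fun t => ?_) h.2
  have hquot : (t : ℝ)⁻¹ • (P t φ - φ) ∈ boundedFunctions E :=
    (boundedSubmodule E).smul_mem _ ((boundedSubmodule E).sub_mem (hP.apply_mem t h.1) h.1)
  simpa only [Pi.smul_def, Pi.sub_apply, smul_eq_mul, div_eq_inv_mul] using hquot

theorem of_integral (hP : IsTransitionSemigroup κ P) {ψ χ : E → ℝ} (hψ : ψ ∈ boundedFunctions E)
    (hχ : χ ∈ strongSpace P)
    (h : ∀ (s : ℝ≥0) x, P s ψ x - ψ x = ∫ v in (0 : ℝ)..s, P v.toNNReal χ x) :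
    HasGenerator P ψ χ := by
  refine ⟨hψ, Metric.tendstoUniformly_iff.2 fun ε hε => ?_⟩
  obtain ⟨δ, hδ, hmod⟩ := NNReal.nhds_zero_basis.eventually_iff.1
    (hP.eventually_abs_apply_sub_lt hχ (half_pos hε))
  refine (nhdsGT_basis (0 : ℝ≥0)).eventually_iff.2 ⟨δ, hδ, fun s hs x => ?_⟩
  have hs0 : (0 : ℝ) < s := NNReal.coe_pos.2 hs.1
  have hmean : (∫ v in (0 : ℝ)..s, P v.toNNReal χ x) / s - χ x =
      (∫ v in (0 : ℝ)..s, (P v.toNNReal χ x - χ x)) / s := by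
    rw [intervalIntegral.integral_sub
      ((hP.continuous_apply_toNNReal hχ x).intervalIntegrable _ _) (by simp),
      intervalIntegral.integral_const, smul_eq_mul, sub_zero]
    field_simp
  have hbound : ‖∫ v in (0 : ℝ)..s, (P v.toNNReal χ x - χ x)‖ ≤ ε / 2 * |(s : ℝ) - 0| := by
    refine intervalIntegral.norm_integral_le_of_norm_le_const fun v hv => (hmod ?_ x).le
    rw [Set.uIoc_of_le hs0.le] at hv
    exact (Real.toNNReal_le_iff_le_coe.2 hv.2).trans_lt hs.2
  rw [sub_zero, abs_of_pos hs0] at hbound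
  rw [dist_comm, Real.dist_eq, h, hmean, abs_div, abs_of_pos hs0]
  exact ((div_le_iff₀ hs0).2 hbound).trans_lt (half_lt_self hε)

theorem sub (hP : IsTransitionSemigroup κ P) (hφ : HasGenerator P φ v)
    (hψ : HasGenerator P ψ w) : HasGenerator P (φ - ψ) (v - w) := by
  simpa only [sub_eq_add_neg, neg_one_smul] using add hP hφ (const_smul hP (-1) hψ)

end HasGenerator

theorem hasGenerator_of_mem_generatorDomain {E : Type*} [MeasurableSpace E]
    {P : ℝ≥0 → (E → ℝ) → E → ℝ} {φ : E → ℝ} (h : φ ∈ generatorDomain P) :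
    HasGenerator P φ (generator P φ) := by
  obtain ⟨hφ, w, hw⟩ := h
  have hgen : HasGenerator P φ w := ⟨hφ, hw⟩
  rwa [hgen.generator_eq]

section IterDomain

variable {E : Type*} [MeasurableSpace E] {P : ℝ≥0 → (E → ℝ) → E → ℝ} {φ : E → ℝ} {n : ℕ}

theorem mem_iterDomain_iff : φ ∈ iterDomain P n ↔
    φ ∈ strongSpace P ∧ ∀ j < n, (generator P)^[j] φ ∈ generatorDomain P := by
  induction n with
  | zero => simp [iterDomain]
  | succ n ih =>
    change φ ∈ iterDomain P n ∧ _ ↔ _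
    rw [ih, and_assoc, Nat.forall_lt_succ_right]

theorem hasGenerator_iterate (h : φ ∈ iterDomain P n) {j : ℕ} (hj : j < n) :
    HasGenerator P ((generator P)^[j] φ) ((generator P)^[j + 1] φ) := by
  rw [Function.iterate_succ_apply']
  exact hasGenerator_of_mem_generatorDomain ((mem_iterDomain_iff.1 h).2 j hj)

theorem iterate_generator_eq {Φ : ℕ → E → ℝ} (h : ∀ j < n, HasGenerator P (Φ j) (Φ (j + 1)))
    {j : ℕ} (hj : j ≤ n) : (generator P)^[j] (Φ 0) = Φ j := by
  induction j with
  | zero => rfl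
  | succ j ih =>
    rw [Function.iterate_succ_apply', ih (Nat.le_of_succ_le hj), (h j hj).generator_eq]

theorem mem_iterDomain_of_hasGenerator {Φ : ℕ → E → ℝ} (h0 : Φ 0 ∈ strongSpace P)
    (h : ∀ j < n, HasGenerator P (Φ j) (Φ (j + 1))) : Φ 0 ∈ iterDomain P n := by
  refine mem_iterDomain_iff.2 ⟨h0, fun j hj => ?_⟩
  rw [iterate_generator_eq h hj.le]
  exact (h j hj).mem_generatorDomain

end IterDomain

end Generator

section IntegrationByParts

variable {F k k' : ℝ → ℝ} {C a : ℝ}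

theorem hasDerivAt_integral_add (hF : Continuous F) (s u : ℝ) :
    HasDerivAt (fun u => ∫ v in 0..s, F (u + v)) (F (u + s) - F u) u := by
  have hprim : ∀ b, HasDerivAt (fun b => ∫ v in (0 : ℝ)..b, F v) (F b) b := fun b =>
    intervalIntegral.integral_hasDerivAt_right (hF.intervalIntegrable _ _)
      (hF.stronglyMeasurableAtFilter _ _) hF.continuousAt
  have hwindow : (fun u => ∫ v in 0..s, F (u + v)) =
      fun u => (∫ v in (0 : ℝ)..(u + s), F v) - ∫ v in (0 : ℝ)..u, F v := by
    funext u
    rw [intervalIntegral.integral_comp_add_left, add_zero,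
      intervalIntegral.integral_interval_sub_left (hF.intervalIntegrable _ _)
        (hF.intervalIntegrable _ _)]
  rw [hwindow]
  exact ((hprim (u + s)).comp_add_const u s).sub (hprim u)

theorem integrable_comp_add_mul {ν : Measure ℝ} (hF : Continuous F) (hC : ∀ u, |F u| ≤ C)
    (hk : Integrable k ν) (s : ℝ) : Integrable (fun u => F (u + s) * k u) ν :=
  hk.bdd_mul (c := C) (by fun_prop) (ae_of_all _ fun _ => hC _)

theorem continuous_integral_comp_add_mul {ν : Measure ℝ} (hF : Continuous F)
    (hC : ∀ u, |F u| ≤ C) (hk : Integrable k ν) :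
    Continuous fun v => ∫ u, F (u + v) * k u ∂ν := by
  refine continuous_of_dominated (bound := fun u => C * |k u|)
    (fun v => (integrable_comp_add_mul hF hC hk v).aestronglyMeasurable)
    (fun v => ae_of_all _ fun u => ?_) (hk.abs.const_mul C) (ae_of_all _ fun u => by fun_prop)
  rw [norm_mul]
  exact mul_le_mul_of_nonneg_right (hC _) (abs_nonneg _)

theorem integral_integral_comp_add_mul {ν : Measure ℝ} [SFinite ν] (hF : Continuous F)
    (hC : ∀ u, |F u| ≤ C) (hk : Integrable k ν) (s : ℝ) :
    ∫ u, (∫ v in 0..s, F (u + v)) * k u ∂ν = ∫ v in 0..s, ∫ u, F (u + v) * k u ∂ν := by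
  have : IsFiniteMeasure ((volume : Measure ℝ).restrict (Set.uIoc 0 s)) :=
    ⟨by rw [Measure.restrict_apply_univ]; exact measure_Ioc_lt_top⟩
  rw [intervalIntegral_integral_swap (f := fun v u => F (u + v) * k u)]
  · simp only [intervalIntegral.integral_mul_const]
  · exact (hk.comp_snd _).bdd_mul (f := fun z : ℝ × ℝ => F (z.2 + z.1)) (c := C)
      (by fun_prop) (ae_of_all _ fun z => hC _)

theorem integral_Ioi_comp_add_sub_mul (hF : Continuous F) (hC : ∀ u, |F u| ≤ C)
    (hk : ∀ u ∈ Set.Ioi a, HasDerivAt k (k' u) u) (hka : ContinuousWithinAt k (Set.Ioi a) a)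
    (hki : IntegrableOn k (Set.Ioi a)) (hki' : IntegrableOn k' (Set.Ioi a)) (s : ℝ) :
    ∫ u in Set.Ioi a, (F (u + s) - F u) * k u =
      -((∫ v in 0..s, F (a + v)) * k a) - ∫ u in Set.Ioi a, (∫ v in 0..s, F (u + v)) * k' u := by
  set W : ℝ → ℝ := fun u => ∫ v in 0..s, F (u + v)
  have hW : ∀ u, HasDerivAt W (F (u + s) - F u) u := hasDerivAt_integral_add hF s
  have hWc : Continuous W := continuous_iff_continuousAt.2 fun u => (hW u).continuousAt
  have hWC : ∀ u, ‖W u‖ ≤ C * |s - 0| := fun u =>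
    intervalIntegral.norm_integral_le_of_norm_le_const fun v _ => hC _
  have hlim : Tendsto (W * k) atTop (𝓝 0) :=
    bdd_le_mul_tendsto_zero' _ (Eventually.of_forall hWC)
      (tendsto_zero_of_hasDerivAt_of_integrableOn_Ioi hk hki' hki)
  have hlima : Tendsto (W * k) (𝓝[>] a) (𝓝 (W a * k a)) := hWc.continuousWithinAt.mul hka
  have hint : IntegrableOn (fun u => (F (u + s) - F u) * k u) (Set.Ioi a) := by
    simp only [sub_mul]
    exact (integrable_comp_add_mul hF hC hki s).sub
      (by simpa only [add_zero] using integrable_comp_add_mul hF hC hki 0)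
  have hparts := integral_Ioi_mul_deriv_eq_deriv_mul (fun u _ => hW u) hk
    (hki'.bdd_mul hWc.aestronglyMeasurable (ae_of_all _ hWC)) hint hlima hlim
  rw [hparts]
  ring

theorem integral_Ioi_comp_add_mul_sub (hF : Continuous F) (hC : ∀ u, |F u| ≤ C)
    (hk : ∀ u ∈ Set.Ioi a, HasDerivAt k (k' u) u) (hka : ContinuousWithinAt k (Set.Ioi a) a)
    (hki : IntegrableOn k (Set.Ioi a)) (hki' : IntegrableOn k' (Set.Ioi a)) (s : ℝ) :
    (∫ u in Set.Ioi a, F (u + s) * k u) - ∫ u in Set.Ioi a, F u * k u =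
      ∫ v in 0..s, -(k a * F (a + v) + ∫ u in Set.Ioi a, F (u + v) * k' u) := by
  have hwindow : IntervalIntegrable (fun v => k a * F (a + v)) volume 0 s :=
    Continuous.intervalIntegrable (by fun_prop) _ _
  have hsub : ∫ u in Set.Ioi a, (F (u + s) - F u) * k u =
      (∫ u in Set.Ioi a, F (u + s) * k u) - ∫ u in Set.Ioi a, F u * k u := by
    simp only [sub_mul]
    exact integral_sub (integrable_comp_add_mul hF hC hki s)
      (by simpa only [add_zero] using integrable_comp_add_mul hF hC hki 0)
  rw [← hsub, integral_Ioi_comp_add_sub_mul hF hC hk hka hki hki', intervalIntegral.integral_neg,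
    intervalIntegral.integral_add hwindow
      ((continuous_integral_comp_add_mul hF hC hki').intervalIntegrable _ _),
    integral_integral_comp_add_mul hF hC hki', intervalIntegral.integral_const_mul]
  ring

end IntegrationByParts

section Potential

/-- The potential `∫₀^∞ P_u φ k(u) du` of `φ` with weight `k`. -/
def potential {E : Type*} (P : ℝ≥0 → (E → ℝ) → E → ℝ) (φ : E → ℝ) (k : ℝ → ℝ) (x : E) : ℝ :=
  ∫ u in Set.Ioi (0 : ℝ), P u.toNNReal φ x * k u

namespace IsTransitionSemigroup

variable {E : Type*} [MeasurableSpace E] {κ : ℝ≥0 → Kernel E E} {P : ℝ≥0 → (E → ℝ) → E → ℝ}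
  {φ : E → ℝ} {k k' : ℝ → ℝ}

theorem integrableOn_apply_add_mul (hP : IsTransitionSemigroup κ P) (hφ : φ ∈ strongSpace P)
    (hk : IntegrableOn k (Set.Ioi 0)) (s : ℝ≥0) (x : E) :
    IntegrableOn (fun u : ℝ => P (u.toNNReal + s) φ x * k u) (Set.Ioi 0) := by
  obtain ⟨C, hC⟩ := hφ.1.2
  have hc : Continuous fun u : ℝ => P (u.toNNReal + s) φ x :=
    (hP.continuous_apply hφ x).comp (continuous_real_toNNReal.add continuous_const)
  exact hk.bdd_mul (c := C) hc.aestronglyMeasurable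
    (ae_of_all _ fun u => hP.abs_apply_le _ hφ.1.1 hC x)

theorem integrableOn_apply_mul (hP : IsTransitionSemigroup κ P) (hφ : φ ∈ strongSpace P)
    (hk : IntegrableOn k (Set.Ioi 0)) (x : E) :
    IntegrableOn (fun u : ℝ => P u.toNNReal φ x * k u) (Set.Ioi 0) := by
  simpa only [add_zero] using hP.integrableOn_apply_add_mul hφ hk 0 x

theorem measurable_uncurry_apply (hP : IsTransitionSemigroup κ P) (hφ : φ ∈ strongSpace P) :
    Measurable fun z : E × ℝ => P z.2.toNNReal φ z.1 := by
  have hjoint := measurable_uncurry_of_continuous_of_measurable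
    (u := fun (u : ℝ) x => P u.toNNReal φ x) (hP.continuous_apply_toNNReal hφ)
    fun u => (hP.apply_mem _ hφ.1).1
  exact hjoint.comp measurable_swap

theorem abs_apply_mul_le (hP : IsTransitionSemigroup κ P) (hφ : Measurable φ) {C : ℝ}
    (hC : ∀ x, |φ x| ≤ C) (t : ℝ≥0) (c : ℝ) (x : E) : ‖P t φ x * c‖ ≤ C * |c| := by
  rw [norm_mul]
  exact mul_le_mul_of_nonneg_right (hP.abs_apply_le _ hφ hC x) (abs_nonneg _)

theorem measurable_potential (hP : IsTransitionSemigroup κ P) (hφ : φ ∈ strongSpace P)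
    (hk : AEStronglyMeasurable k (volume.restrict (Set.Ioi 0))) :
    Measurable (potential P φ k) := by
  have hmk : potential P φ k = potential P φ (hk.mk k) := by
    funext x
    refine integral_congr_ae ?_
    filter_upwards [hk.ae_eq_mk] with u hu
    rw [hu]
  rw [hmk]
  have hjoint : Measurable fun z : E × ℝ => P z.2.toNNReal φ z.1 * hk.mk k z.2 :=
    (hP.measurable_uncurry_apply hφ).mul
      (hk.stronglyMeasurable_mk.measurable.comp measurable_snd)
  exact hjoint.stronglyMeasurable.integral_prod_right'.measurable

theorem potential_mem_boundedFunctions (hP : IsTransitionSemigroup κ P) (hφ : φ ∈ strongSpace P)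
    (hk : IntegrableOn k (Set.Ioi 0)) : potential P φ k ∈ boundedFunctions E := by
  obtain ⟨C, hC⟩ := hφ.1.2
  exact ⟨hP.measurable_potential hφ hk.aestronglyMeasurable,
    ∫ u in Set.Ioi (0 : ℝ), C * |k u|, fun x => norm_integral_le_of_norm_le (hk.abs.const_mul C)
      (ae_of_all _ fun u => hP.abs_apply_mul_le hφ.1.1 hC _ _ x)⟩

theorem apply_potential (hP : IsTransitionSemigroup κ P) (hφ : φ ∈ strongSpace P)
    (hk : IntegrableOn k (Set.Ioi 0)) (s : ℝ≥0) (x : E) :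
    P s (potential P φ k) x = ∫ u in Set.Ioi (0 : ℝ), P (u.toNNReal + s) φ x * k u := by
  have := hP.markov s
  obtain ⟨C, hC⟩ := hφ.1.2
  have hint : Integrable (fun z : E × ℝ => P z.2.toNNReal φ z.1 * k z.2)
      ((κ s x).prod (volume.restrict (Set.Ioi 0))) :=
    (Integrable.comp_snd (hk.abs.const_mul C) _).mono'
      ((hP.measurable_uncurry_apply hφ).aestronglyMeasurable.mul
        hk.aestronglyMeasurable.comp_snd)
      (ae_of_all _ fun z => hP.abs_apply_mul_le hφ.1.1 hC _ _ _)
  rw [hP.apply _ _ _ (hP.potential_mem_boundedFunctions hφ hk).1]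
  unfold potential
  rw [integral_integral_swap hint]
  refine integral_congr_ae (ae_of_all _ fun u => ?_)
  simp only
  rw [integral_mul_const, ← hP.apply _ _ _ (hP.apply_mem _ hφ.1).1, hP.apply_apply _ _ hφ.1,
    add_comm]

theorem potential_mem_strongSpace (hP : IsTransitionSemigroup κ P) (hφ : φ ∈ strongSpace P)
    (hk : IntegrableOn k (Set.Ioi 0)) : potential P φ k ∈ strongSpace P := by
  refine mem_strongSpace_of_abs_sub_le hφ (hP.potential_mem_boundedFunctions hφ hk)
    (K := ∫ u in Set.Ioi 0, |k u|) (integral_nonneg fun u => abs_nonneg _) fun t _ C hC x => ?_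
  rw [hP.apply_potential hφ hk, potential, mul_comm _ C, ← integral_const_mul C,
    ← integral_sub (hP.integrableOn_apply_add_mul hφ hk t x) (hP.integrableOn_apply_mul hφ hk x),
    ← Real.norm_eq_abs]
  refine norm_integral_le_of_norm_le (hk.abs.const_mul C) (ae_of_all _ fun u => ?_)
  rw [← sub_mul, norm_mul]
  exact mul_le_mul_of_nonneg_right (hP.abs_apply_add_sub_le _ _ hφ.1 hC x) (abs_nonneg _)

theorem hasGenerator_potential (hP : IsTransitionSemigroup κ P) (hφ : φ ∈ strongSpace P)
    (hk : ∀ u ∈ Set.Ioi 0, HasDerivAt k (k' u) u) (hk0 : ContinuousWithinAt k (Set.Ioi 0) 0)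
    (hki : IntegrableOn k (Set.Ioi 0)) (hki' : IntegrableOn k' (Set.Ioi 0)) :
    HasGenerator P (potential P φ k) ((-1 : ℝ) • (k 0 • φ + potential P φ k')) := by
  have hψ := hP.const_smul_mem_strongSpace (k 0) hφ
  have hpot := hP.potential_mem_strongSpace hφ hki'
  have hsum := hP.add_mem_strongSpace hψ hpot
  refine HasGenerator.of_integral hP (hP.potential_mem_boundedFunctions hφ hki)
    (hP.const_smul_mem_strongSpace (-1) hsum) fun s x => ?_
  obtain ⟨C, hC⟩ := hφ.1.2
  have hshift : ∀ (l : ℝ → ℝ) (v : ℝ), 0 ≤ v → ∫ u in Set.Ioi (0 : ℝ),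
      P (u.toNNReal + v.toNNReal) φ x * l u =
        ∫ u in Set.Ioi (0 : ℝ), P (u + v).toNNReal φ x * l u := fun l v hv =>
    setIntegral_congr_fun measurableSet_Ioi fun u hu => by rw [Real.toNNReal_add hu.le hv]
  have hparts := integral_Ioi_comp_add_mul_sub (hP.continuous_apply_toNNReal hφ x)
    (fun u => hP.abs_apply_le _ hφ.1.1 hC x) hk hk0 hki hki' s
  rw [← hshift k s s.2, Real.toNNReal_coe] at hparts
  rw [hP.apply_potential hφ hki, potential, hparts]
  refine intervalIntegral.integral_congr fun v hv => ?_
  rw [Set.uIcc_of_le s.coe_nonneg] at hv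
  rw [hP.apply_const_smul _ _ hsum.1.1, hP.apply_add _ hψ.1 hpot.1,
    hP.apply_const_smul _ _ hφ.1.1, neg_one_smul]
  simp only [Pi.neg_apply, Pi.add_apply, Pi.smul_apply, smul_eq_mul, zero_add,
    hP.apply_potential hφ hki', hshift k' v hv.1]

theorem potential_sum_mul (hP : IsTransitionSemigroup κ P) (hφ : φ ∈ strongSpace P) {ι : Type*}
    {s : Finset ι} {c : ι → ℝ} {k : ι → ℝ → ℝ} (hk : ∀ i ∈ s, IntegrableOn (k i) (Set.Ioi 0))
    (x : E) :
    potential P φ (fun u => ∑ i ∈ s, c i * k i u) x = ∑ i ∈ s, c i * potential P φ (k i) x := by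
  simp only [potential, Finset.mul_sum, mul_left_comm _ (c _)]
  rw [integral_finsetSum _ fun i hi => (hP.integrableOn_apply_mul hφ (hk i hi) x).const_mul (c i)]
  simp only [integral_const_mul]

end IsTransitionSemigroup

end Potential

section PotentialJet

/-- The boundary contributions `∑_{l < j} (-1)^l a_l A^{j-1-l} φ` of `j` successive integrations by
parts, where `a l` is the value at `0` of the `l`-th derivative of the weight. -/
def traceSum {E : Type*} (A : (E → ℝ) → E → ℝ) (φ : E → ℝ) (a : ℕ → ℝ) (j : ℕ) : E → ℝ :=
  ∑ l ∈ Finset.range j, ((-1) ^ l * a l) • A^[j - 1 - l] φ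

/-- For a sequence `K j` of weights with `(K j)' = K (j + 1)`, the closed form of the `j`-th power
of the generator applied to `∫₀^∞ P_u φ K₀(u) du`. -/
def potentialJet {E : Type*} (P : ℝ≥0 → (E → ℝ) → E → ℝ) (φ : E → ℝ) (K : ℕ → ℝ → ℝ) (j : ℕ) :
    E → ℝ :=
  (-1 : ℝ) ^ j • potential P φ (K j) - traceSum (generator P) φ (fun l => K l 0) j

theorem potentialJet_zero {E : Type*} (P : ℝ≥0 → (E → ℝ) → E → ℝ) (φ : E → ℝ) (K : ℕ → ℝ → ℝ) :
    potentialJet P φ K 0 = potential P φ (K 0) := by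
  simp [potentialJet, traceSum]

namespace IsTransitionSemigroup

variable {E : Type*} [MeasurableSpace E] {κ : ℝ≥0 → Kernel E E} {P : ℝ≥0 → (E → ℝ) → E → ℝ}
  {φ : E → ℝ} {r j : ℕ}

theorem hasGenerator_traceSum (hP : IsTransitionSemigroup κ P) (hφ : φ ∈ iterDomain P (r - 1))
    (a : ℕ → ℝ) (hj : j < r) : HasGenerator P (traceSum (generator P) φ a j)
      (traceSum (generator P) φ a (j + 1) - ((-1) ^ j * a j) • φ) := by
  have hlast : traceSum (generator P) φ a (j + 1) - ((-1) ^ j * a j) • φ =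
      ∑ l ∈ Finset.range j, ((-1) ^ l * a l) • (generator P)^[j - l] φ := by
    simp [traceSum, Finset.sum_range_succ]
  rw [hlast]
  refine HasGenerator.sum hP fun l hl => HasGenerator.const_smul hP _ ?_
  have hlj : l < j := Finset.mem_range.1 hl
  have hpow := hasGenerator_iterate hφ (j := j - 1 - l) (by omega)
  rwa [show j - 1 - l + 1 = j - l by omega] at hpow

theorem hasGenerator_potentialJet (hP : IsTransitionSemigroup κ P)
    (hφ : φ ∈ iterDomain P (r - 1)) {K : ℕ → ℝ → ℝ}
    (hK : ∀ j < r, ∀ u, HasDerivAt (K j) (K (j + 1) u) u)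
    (hKi : ∀ j ≤ r, IntegrableOn (K j) (Set.Ioi 0)) (hj : j < r) :
    HasGenerator P (potentialJet P φ K j) (potentialJet P φ K (j + 1)) := by
  have hpot := hP.hasGenerator_potential (mem_iterDomain_iff.1 hφ).1 (fun u _ => hK j hj u)
    (hK j hj 0).continuousAt.continuousWithinAt (hKi j hj.le) (hKi (j + 1) hj)
  convert (hpot.const_smul hP ((-1) ^ j)).sub hP
    (hP.hasGenerator_traceSum hφ (fun l => K l 0) hj) using 1
  · rfl
  · rw [potentialJet, pow_succ]
    module

end IsTransitionSemigroup

end PotentialJet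

section Intertwining

namespace IsDensityKernel

variable {E F : Type*} [MeasurableSpace E] [MeasureSpace F] {Λ : E → F → ℝ} {φ ψ : F → ℝ}

theorem integrable (hΛ : IsDensityKernel Λ) (z : E) : Integrable (Λ z) := by
  refine ⟨hΛ.1.of_uncurry_left.aestronglyMeasurable, ?_⟩
  rw [hasFiniteIntegral_iff_ofReal (ae_of_all _ (hΛ.2.1 z)), hΛ.2.2 z]
  exact ENNReal.one_lt_top

theorem integral_eq_one (hΛ : IsDensityKernel Λ) (z : E) : ∫ x, Λ z x = 1 := by
  rw [integral_eq_lintegral_of_nonneg_ae (ae_of_all _ (hΛ.2.1 z))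
    (hΛ.integrable z).aestronglyMeasurable, hΛ.2.2 z, ENNReal.toReal_one]

theorem integrable_mul (hΛ : IsDensityKernel Λ) (hφ : φ ∈ boundedFunctions F) (z : E) :
    Integrable fun x => Λ z x * φ x := by
  obtain ⟨hφm, C, hC⟩ := hφ
  exact (hΛ.integrable z).mul_bdd hφm.aestronglyMeasurable (ae_of_all _ hC)

theorem abs_kernelOp_le (hΛ : IsDensityKernel Λ) {C : ℝ} (hC : ∀ x, |φ x| ≤ C) (z : E) :
    |kernelOp Λ φ z| ≤ C := by
  calc |kernelOp Λ φ z| ≤ ∫ x, Λ z x * C := by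
        rw [← Real.norm_eq_abs]
        refine norm_integral_le_of_norm_le ((hΛ.integrable z).mul_const C)
          (ae_of_all _ fun x => ?_)
        rw [norm_mul, Real.norm_of_nonneg (hΛ.2.1 z x)]
        exact mul_le_mul_of_nonneg_left (hC x) (hΛ.2.1 z x)
    _ = C := by rw [integral_mul_const, hΛ.integral_eq_one, one_mul]

theorem kernelOp_mem_boundedFunctions [SFinite (volume : Measure F)] (hΛ : IsDensityKernel Λ)
    (hφ : φ ∈ boundedFunctions F) : kernelOp Λ φ ∈ boundedFunctions E := by
  obtain ⟨hφm, C, hC⟩ := hφ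
  have hjoint : Measurable fun z : E × F => Λ z.1 z.2 * φ z.2 :=
    hΛ.1.mul (hφm.comp measurable_snd)
  exact ⟨hjoint.stronglyMeasurable.integral_prod_right'.measurable, C, hΛ.abs_kernelOp_le hC⟩

theorem kernelOp_sub (hΛ : IsDensityKernel Λ) (hφ : φ ∈ boundedFunctions F)
    (hψ : ψ ∈ boundedFunctions F) : kernelOp Λ (φ - ψ) = kernelOp Λ φ - kernelOp Λ ψ := by
  funext z
  simp only [kernelOp, Pi.sub_apply, mul_sub]
  exact integral_sub (hΛ.integrable_mul hφ z) (hΛ.integrable_mul hψ z)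

theorem tendstoUniformly_kernelOp (hΛ : IsDensityKernel Λ) {ι : Type*} {l : Filter ι}
    {G : ι → F → ℝ} {w : F → ℝ} (hG : ∀ i, G i ∈ boundedFunctions F)
    (hw : w ∈ boundedFunctions F) (h : TendstoUniformly G w l) :
    TendstoUniformly (fun i => kernelOp Λ (G i)) (kernelOp Λ w) l := by
  refine Metric.tendstoUniformly_iff.2 fun ε hε => ?_
  filter_upwards [Metric.tendstoUniformly_iff.1 h (ε / 2) (half_pos hε)] with i hi z
  rw [Real.dist_eq, ← Pi.sub_apply, ← hΛ.kernelOp_sub hw (hG i)]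
  exact (hΛ.abs_kernelOp_le (fun x => (hi x).le) z).trans_lt (half_lt_self hε)

end IsDensityKernel

theorem kernelOp_const_smul {E F : Type*} [MeasureSpace F] (Λ : E → F → ℝ) (c : ℝ) (φ : F → ℝ) :
    kernelOp Λ (c • φ) = c • kernelOp Λ φ := by
  funext z
  simp only [kernelOp, Pi.smul_apply, smul_eq_mul, mul_left_comm _ c, integral_const_mul]

namespace IsIntertwining

variable {E F : Type*} [MeasurableSpace E] [MeasureSpace F] [SFinite (volume : Measure F)]
  {Λ : E → F → ℝ} {κ : ℝ≥0 → Kernel F F} {PX : ℝ≥0 → (F → ℝ) → F → ℝ}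
  {PU : ℝ≥0 → (E → ℝ) → E → ℝ} {φ w : F → ℝ}

theorem hasGenerator_kernelOp (hΛ : IsIntertwining PX PU Λ) (hPX : IsTransitionSemigroup κ PX)
    (h : HasGenerator PX φ w) : HasGenerator PU (kernelOp Λ φ) (kernelOp Λ w) := by
  have hdiff : ∀ t, PX t φ - φ ∈ boundedFunctions F := fun t =>
    (boundedSubmodule F).sub_mem (hPX.apply_mem t h.1) h.1
  have hquot : TendstoUniformly (fun t : ℝ≥0 => (t : ℝ)⁻¹ • (PX t φ - φ)) w (𝓝[>] 0) := by
    simpa only [Pi.smul_def, Pi.sub_apply, smul_eq_mul, div_eq_inv_mul] using h.2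
  have hkernel := hΛ.1.tendstoUniformly_kernelOp
    (fun t => (boundedSubmodule F).smul_mem _ (hdiff t)) (h.mem_boundedFunctions hPX) hquot
  refine ⟨hΛ.1.kernelOp_mem_boundedFunctions h.1, Metric.tendstoUniformly_iff.2 fun ε hε => ?_⟩
  filter_upwards [Metric.tendstoUniformly_iff.1 hkernel ε hε, self_mem_nhdsWithin] with t hlt ht z
  simpa only [kernelOp_const_smul, hΛ.1.kernelOp_sub (hPX.apply_mem t h.1) h.1, hΛ.2 t ht φ h.1,
    Pi.smul_apply, Pi.sub_apply, smul_eq_mul, div_eq_inv_mul] using hlt z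

theorem kernelOp_mem_strongSpace (hΛ : IsIntertwining PX PU Λ) (hPX : IsTransitionSemigroup κ PX)
    (hφ : φ ∈ strongSpace PX) : kernelOp Λ φ ∈ strongSpace PU := by
  have hkernel := hΛ.1.tendstoUniformly_kernelOp (fun t => hPX.apply_mem t hφ.1) hφ.1 hφ.2
  refine ⟨hΛ.1.kernelOp_mem_boundedFunctions hφ.1, Metric.tendstoUniformly_iff.2 fun ε hε => ?_⟩
  filter_upwards [Metric.tendstoUniformly_iff.1 hkernel ε hε, self_mem_nhdsWithin] with t hlt ht z
  rw [hΛ.2 t ht φ hφ.1]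
  exact hlt z

theorem kernelOp_mem_iterDomain (hΛ : IsIntertwining PX PU Λ) (hPX : IsTransitionSemigroup κ PX)
    {n : ℕ} (hφ : φ ∈ iterDomain PX n) : kernelOp Λ φ ∈ iterDomain PU n :=
  mem_iterDomain_of_hasGenerator (Φ := fun j => kernelOp Λ ((generator PX)^[j] φ))
    (hΛ.kernelOp_mem_strongSpace hPX (mem_iterDomain_iff.1 hφ).1)
    fun _ hj => hΛ.hasGenerator_kernelOp hPX (hasGenerator_iterate hφ hj)

end IsIntertwining

end Intertwining

section Diffusion

namespace IsDiffusion

variable {Ω E : Type*} [MeasurableSpace Ω] [TopologicalSpace E] [MeasurableSpace E]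
  {μ : Measure Ω} {X : E → ℝ≥0 → Ω → E}

theorem measurable (hX : IsDiffusion μ X) (x : E) (t : ℝ≥0) : Measurable (X x t) :=
  hX.1 x t

theorem ae_start_eq (hX : IsDiffusion μ X) (x : E) : ∀ᵐ ω ∂μ, X x 0 ω = x :=
  hX.2.1 x

theorem ae_continuous (hX : IsDiffusion μ X) (x : E) : ∀ᵐ ω ∂μ, Continuous fun t => X x t ω :=
  hX.2.2.1 x

theorem exists_kernel [IsProbabilityMeasure μ] (hX : IsDiffusion μ X) :
    ∃ κ : ℝ≥0 → Kernel E E, (∀ t, IsMarkovKernel (κ t)) ∧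
      ∀ x s t, μ.map (X x (s + t)) = (μ.map (X x s)).bind (κ t) := by
  obtain ⟨hmeas, -, -, κ, hκ, hmarkov⟩ := hX
  refine ⟨κ, hκ, fun x s t => ?_⟩
  have hpast : (⨆ τ ∈ Set.Iic s, MeasurableSpace.comap (X x τ) inferInstance) ≤
      (inferInstance : MeasurableSpace Ω) :=
    iSup₂_le fun τ _ => (hmeas x τ).comap_le
  have := Measure.isProbabilityMeasure_map (μ := μ) (hmeas x s).aemeasurable
  have := Measure.isProbabilityMeasure_map (μ := μ) (hmeas x (s + t)).aemeasurable
  refine Measure.ext fun A hA => ?_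
  rw [← measureReal_eq_measureReal_iff, map_measureReal_apply (hmeas x _) hA]
  calc μ.real (X x (s + t) ⁻¹' A)
      = ∫ ω, (X x (s + t) ⁻¹' A).indicator (fun _ => (1 : ℝ)) ω ∂μ := by
        simp [integral_indicator_const _ (hmeas x _ hA)]
    _ = ∫ ω, (κ t (X x s ω)).real A ∂μ := by
        rw [← integral_congr_ae (hmarkov x s t A hA), integral_condExp hpast]
    _ = ((μ.map (X x s)).bind (κ t)).real A := by
        rw [measureReal_def, Measure.bind_apply hA (κ t).aemeasurable,
          lintegral_map ((κ t).measurable_coe hA) (hmeas x s)]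
        exact integral_toReal (((κ t).measurable_coe hA).comp (hmeas x s)).aemeasurable
          (ae_of_all _ fun ω => measure_lt_top _ _)

theorem map_start [IsProbabilityMeasure μ] (hX : IsDiffusion μ X) (x : E) :
    μ.map (X x 0) = Measure.dirac x := by
  rw [Measure.map_congr (hX.ae_start_eq x), Measure.map_const, measure_univ, one_smul]

theorem exists_isTransitionSemigroup [IsProbabilityMeasure μ] (hX : IsDiffusion μ X) :
    ∃ κ, IsTransitionSemigroup κ (semigroup μ X) := by
  obtain ⟨κ, hκ, hbind⟩ := hX.exists_kernel
  have hlaw : ∀ x t, μ.map (X x t) = κ t x := fun x t => by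
    rw [← zero_add t, hbind, hX.map_start, Measure.dirac_bind (κ t).measurable, zero_add]
  refine ⟨κ, hκ, fun t φ x hφ => ?_, fun x => by rw [← hlaw, hX.map_start], fun s t => ?_⟩
  · rw [← hlaw, integral_map (hX.measurable x t).aemeasurable hφ.aestronglyMeasurable]
    rfl
  · refine Kernel.ext fun x => ?_
    rw [Kernel.comp_apply, ← hlaw, ← hlaw, hbind]

theorem iteratedMean_zero [IsProbabilityMeasure μ] (hX : IsDiffusion μ X) {Y : ℝ≥0 → Ω → ℝ}
    (hY : ∀ᵐ ω ∂μ, Y 0 ω = 0) (φ : E → ℝ) : iteratedMean μ X Y φ 0 = φ := by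
  funext x
  have hconst : (fun ω => φ (X x (Real.nnabs (Y (Real.toNNReal 0) ω)) ω)) =ᵐ[μ] fun _ => φ x := by
    filter_upwards [hY, hX.ae_start_eq x] with ω hYω hXω
    rw [Real.toNNReal_zero, hYω, map_zero, hXω]
  rw [iteratedMean, integral_congr_ae hconst, integral_const, probReal_univ, one_smul]

end IsDiffusion

end Diffusion

section IndependentTime

theorem measurable_eval_simpleFunc {ι E : Type*} [MeasurableSpace ι] [MeasurableSingletonClass ι]
    [MeasurableSpace E] (f : SimpleFunc ι ι) :
    Measurable fun z : (ι → E) × ι => z.1 (f z.2) := by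
  have heval : Measurable fun z : (ι → E) × f.range => z.1 z.2 :=
    measurable_from_prod_countable_left fun s => measurable_pi_apply (s : ι)
  have happrox : Measurable fun z : (ι → E) × ι =>
      (z.1, (⟨f z.2, f.mem_range_self z.2⟩ : f.range)) :=
    measurable_fst.prodMk ((f.measurable.comp measurable_snd).subtype_mk)
  exact heval.comp happrox

variable {Ω Ω' E : Type*} [MeasurableSpace Ω] [MeasurableSpace Ω'] {μ : Measure Ω} {ν : Measure Ω'}
  [TopologicalSpace E] [TopologicalSpace.PseudoMetrizableSpace E] [MeasurableSpace E]
  [BorelSpace E]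

theorem identDistrib_of_ae_tendsto [IsProbabilityMeasure μ] [IsProbabilityMeasure ν]
    {F : ℕ → Ω → E} {G : ℕ → Ω' → E} {f : Ω → E} {g : Ω' → E}
    (h : ∀ k, IdentDistrib (F k) (G k) μ ν)
    (hF : ∀ᵐ ω ∂μ, Tendsto (fun k => F k ω) atTop (𝓝 (f ω)))
    (hG : ∀ᵐ ω ∂ν, Tendsto (fun k => G k ω) atTop (𝓝 (g ω))) : IdentDistrib f g μ ν := by
  have hf := aemeasurable_of_tendsto_metrizable_ae' (fun k => (h k).aemeasurable_fst) hF
  have hg := aemeasurable_of_tendsto_metrizable_ae' (fun k => (h k).aemeasurable_snd) hG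
  have hFf := tendstoInDistribution_of_ae_tendsto (fun k => (h k).aemeasurable_fst) hf hF
  have hGg := tendstoInDistribution_of_ae_tendsto (fun k => (h k).aemeasurable_snd) hg hG
  have hFg : TendstoInDistribution F atTop g (fun _ => μ) ν :=
    ⟨hFf.forall_aemeasurable, hg, by simpa only [(h _).map_eq] using hGg.tendsto⟩
  exact ⟨hf, hg, tendstoInDistribution_unique F hFf hFg⟩

theorem identDistrib_eval_time {ι : Type*} [TopologicalSpace ι] [TopologicalSpace.MetrizableSpace ι]
    [SecondCountableTopology ι] [MeasurableSpace ι] [OpensMeasurableSpace ι]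
    [IsProbabilityMeasure μ] [IsProbabilityMeasure ν]
    {X : ι → Ω → E} {T : Ω → ι} {X' : ι → Ω' → E} {T' : Ω' → ι}
    (h : IdentDistrib (fun ω => (fun t => X t ω, T ω)) (fun ω => (fun t => X' t ω, T' ω)) μ ν)
    (hX : ∀ᵐ ω ∂μ, Continuous fun t => X t ω) (hX' : ∀ᵐ ω ∂ν, Continuous fun t => X' t ω) :
    IdentDistrib (fun ω => X (T ω) ω) (fun ω => X' (T' ω) ω) μ ν := by
  have hid : StronglyMeasurable (id : ι → ι) := stronglyMeasurable_id
  refine identDistrib_of_ae_tendsto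
    (fun k => h.comp (measurable_eval_simpleFunc (hid.approx k))) ?_ ?_
  · filter_upwards [hX] with ω hω
    exact (hω.tendsto _).comp (hid.tendsto_approx _)
  · filter_upwards [hX'] with ω hω
    exact (hω.tendsto _).comp (hid.tendsto_approx _)

theorem integral_eval_indep_time [IsProbabilityMeasure μ] {ι : Type*} [TopologicalSpace ι]
    [TopologicalSpace.MetrizableSpace ι] [SecondCountableTopology ι] [MeasurableSpace ι]
    [OpensMeasurableSpace ι] {X : ι → Ω → E} {T : Ω → ι} (hX : ∀ t, Measurable (X t))
    (hc : ∀ᵐ ω ∂μ, Continuous fun t => X t ω) (hT : Measurable T)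
    (hXT : IndepFun (fun ω t => X t ω) T μ) {φ : E → ℝ} (hφ : φ ∈ boundedFunctions E) :
    ∫ ω, φ (X (T ω) ω) ∂μ = ∫ ω, ∫ ω', φ (X (T ω) ω') ∂μ ∂μ := by
  have hpath : Measurable fun ω t => X t ω := measurable_pi_lambda _ hX
  have hfst : IdentDistrib (fun ω t => X t ω) (fun z : Ω × Ω => fun t => X t z.1) μ (μ.prod μ) :=
    ⟨hpath.aemeasurable, (hpath.comp measurable_fst).aemeasurable, by
      rw [← Function.comp_def (fun ω t => X t ω) Prod.fst, ← Measure.map_map hpath measurable_fst,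
        measurePreserving_fst.map_eq]⟩
  have hsnd : IdentDistrib T (fun z : Ω × Ω => T z.2) μ (μ.prod μ) :=
    ⟨hT.aemeasurable, (hT.comp measurable_snd).aemeasurable, by
      rw [← Function.comp_def T Prod.snd, ← Measure.map_map hT measurable_snd,
        measurePreserving_snd.map_eq]⟩
  have hdistrib : IdentDistrib (fun ω => X (T ω) ω) (fun z : Ω × Ω => X (T z.2) z.1) μ
      (μ.prod μ) :=
    identDistrib_eval_time (hfst.prodMk hsnd hXT (indepFun_prod hpath hT)) hc
      (Measure.quasiMeasurePreserving_fst.ae hc)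
  obtain ⟨hφm, C, hC⟩ := hφ
  have hφX := hdistrib.comp hφm
  refine hφX.integral_eq.trans (integral_prod_symm _ ?_)
  exact Integrable.of_bound hφX.aemeasurable_snd.aestronglyMeasurable C (ae_of_all _ fun z => hC _)

end IndependentTime

section TimeDerivatives

section IteratedDeriv

variable {𝕜 E : Type*} [NontriviallyNormedField 𝕜] [NormedAddCommGroup E] [NormedSpace 𝕜 E]
  {S : Set 𝕜} {f : 𝕜 → E} {G : ℕ → 𝕜 → E} {N i : ℕ}

theorem eqOn_iteratedDeriv_of_hasDerivAt (hS : IsOpen S) (h0 : Set.EqOn f (G 0) S)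
    (h : ∀ i < N, ∀ t ∈ S, HasDerivAt (G i) (G (i + 1) t) t) (hi : i ≤ N) :
    Set.EqOn (iteratedDeriv i f) (G i) S := by
  induction i with
  | zero => simpa only [iteratedDeriv_zero] using h0
  | succ i ih =>
    intro t ht
    rw [iteratedDeriv_succ, ((ih (by omega)).eventuallyEq_of_mem (hS.mem_nhds ht)).deriv_eq]
    exact (h i hi t ht).deriv

end IteratedDeriv

/-- `K'` is the derivative of `s ↦ K s` at `t` in the sense of `L¹(ν)`. -/
def HasL1DerivAt {γ : Type*} [MeasurableSpace γ] (ν : Measure γ) (K : ℝ → γ → ℝ) (K' : γ → ℝ)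
    (t : ℝ) : Prop :=
  Tendsto (fun s => ∫⁻ u, ‖(K s u - K t u) / (s - t) - K' u‖ₑ ∂ν) (𝓝[≠] t) (𝓝 0)

section HasL1DerivAt

variable {γ : Type*} [MeasurableSpace γ] {ν : Measure γ} {K : ℝ → γ → ℝ} {K' F : γ → ℝ} {t : ℝ}

theorem aestronglyMeasurable_of_hasDerivAt (hK : ∀ᶠ s in 𝓝 t, AEStronglyMeasurable (K s) ν)
    (hd : ∀ u, HasDerivAt (fun s => K s u) (K' u) t) : AEStronglyMeasurable K' ν := by
  obtain ⟨s, hst, hs⟩ := exists_seq_forall_of_frequently (hK.filter_mono nhdsWithin_le_nhds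
    : ∀ᶠ s in 𝓝[≠] t, AEStronglyMeasurable (K s) ν).frequently
  refine aestronglyMeasurable_of_tendsto_ae atTop
    (f := fun n u => (s n - t)⁻¹ • (K (s n) u - K t u))
    (fun n => ((hs n).sub hK.self_of_nhds).const_smul (s n - t)⁻¹) (ae_of_all _ fun u => ?_)
  exact (hasDerivAt_iff_tendsto_slope.1 (hd u)).comp hst

namespace HasL1DerivAt

theorem integrable (h : HasL1DerivAt ν K K' t) (hK : ∀ᶠ s in 𝓝 t, Integrable (K s) ν)
    (hd : ∀ u, HasDerivAt (fun s => K s u) (K' u) t) : Integrable K' ν := by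
  have hK' : AEStronglyMeasurable K' ν :=
    aestronglyMeasurable_of_hasDerivAt (hK.mono fun _ hs => hs.1) hd
  obtain ⟨s, hlt, hs⟩ :=
    ((h.eventually_lt_const one_pos).and (hK.filter_mono nhdsWithin_le_nhds)).exists
  have hquot : Integrable (fun u => (K s u - K t u) / (s - t)) ν :=
    (hs.sub hK.self_of_nhds).div_const _
  have hdiff : Integrable (fun u => (K s u - K t u) / (s - t) - K' u) ν :=
    ⟨hquot.1.sub hK', hlt.trans ENNReal.one_lt_top⟩
  exact (hquot.sub hdiff).congr (ae_of_all _ fun u => sub_sub_cancel _ _)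

theorem restrict (h : HasL1DerivAt ν K K' t) (S : Set γ) : HasL1DerivAt (ν.restrict S) K K' t :=
  tendsto_of_tendsto_of_tendsto_of_le_of_le tendsto_const_nhds h (fun _ => zero_le)
    fun _ => setLIntegral_le_lintegral _ _

theorem bdd_mul (h : HasL1DerivAt ν K K' t) {C : ℝ} (hC : ∀ u, |F u| ≤ C) :
    HasL1DerivAt ν (fun s u => F u * K s u) (fun u => F u * K' u) t := by
  have hC' := ENNReal.Tendsto.const_mul (a := ENNReal.ofReal C) h (Or.inr ENNReal.ofReal_ne_top)
  rw [mul_zero] at hC'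
  refine tendsto_of_tendsto_of_tendsto_of_le_of_le tendsto_const_nhds hC' (fun _ => zero_le)
    fun s => ?_
  rw [← lintegral_const_mul' _ _ ENNReal.ofReal_ne_top]
  refine lintegral_mono fun u => ?_
  rw [← mul_sub, mul_div_assoc, ← mul_sub, enorm_mul, Real.enorm_eq_ofReal_abs (F u)]
  gcongr
  exact hC u

theorem hasDerivAt_integral (h : HasL1DerivAt ν K K' t) (hK : ∀ᶠ s in 𝓝 t, Integrable (K s) ν)
    (hK' : Integrable K' ν) : HasDerivAt (fun s => ∫ u, K s u ∂ν) (∫ u, K' u ∂ν) t := by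
  have hKt : Integrable (K t) ν := hK.self_of_nhds
  have hKs : ∀ᶠ s in 𝓝[≠] t, Integrable (K s) ν := hK.filter_mono nhdsWithin_le_nhds
  rw [hasDerivAt_iff_tendsto_slope]
  refine (tendsto_integral_of_L1 K' hK'.1
    (hKs.mono fun s hs => (hs.sub hKt).div_const (s - t)) h).congr' (hKs.mono fun s hs => ?_)
  simp only [Pi.sub_apply]
  rw [slope_def_field, integral_div, integral_sub hs hKt]

end HasL1DerivAt

end HasL1DerivAt

end TimeDerivatives

section TimeDependentWeights

variable {E : Type*} {t : ℝ} {j : ℕ}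

theorem hasDerivAt_traceSum (A : (E → ℝ) → E → ℝ) (φ : E → ℝ) {a : ℝ → ℕ → ℝ} {a' : ℕ → ℝ}
    (ha : ∀ l < j, HasDerivAt (fun s => a s l) (a' l) t) (x : E) :
    HasDerivAt (fun s => traceSum A φ (a s) j x) (traceSum A φ a' j x) t := by
  simp only [traceSum, Finset.sum_apply, Pi.smul_apply, smul_eq_mul]
  exact HasDerivAt.fun_sum fun l hl => ((ha l (Finset.mem_range.1 hl)).const_mul _).mul_const _

namespace IsTransitionSemigroup

variable [MeasurableSpace E] {κ : ℝ≥0 → Kernel E E} {P : ℝ≥0 → (E → ℝ) → E → ℝ} {φ : E → ℝ}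

theorem hasDerivAt_potential (hP : IsTransitionSemigroup κ P) (hφ : φ ∈ strongSpace P)
    {k : ℝ → ℝ → ℝ} {k' : ℝ → ℝ} (hk : ∀ᶠ s in 𝓝 t, IntegrableOn (k s) (Set.Ioi 0))
    (hk' : IntegrableOn k' (Set.Ioi 0)) (h : HasL1DerivAt (volume.restrict (Set.Ioi 0)) k k' t)
    (x : E) : HasDerivAt (fun s => potential P φ (k s) x) (potential P φ k' x) t := by
  obtain ⟨C, hC⟩ := hφ.1.2
  exact (h.bdd_mul fun u => hP.abs_apply_le _ hφ.1.1 hC x).hasDerivAt_integral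
    (hk.mono fun _ hs => hP.integrableOn_apply_mul hφ hs x) (hP.integrableOn_apply_mul hφ hk' x)

theorem hasDerivAt_potentialJet (hP : IsTransitionSemigroup κ P) (hφ : φ ∈ strongSpace P)
    {K : ℝ → ℕ → ℝ → ℝ} {K' : ℕ → ℝ → ℝ} (hK : ∀ᶠ s in 𝓝 t, IntegrableOn (K s j) (Set.Ioi 0))
    (hK' : IntegrableOn (K' j) (Set.Ioi 0))
    (h : HasL1DerivAt (volume.restrict (Set.Ioi 0)) (fun s => K s j) (K' j) t)
    (h0 : ∀ l < j, HasDerivAt (fun s => K s l 0) (K' l 0) t) (x : E) :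
    HasDerivAt (fun s => potentialJet P φ (K s) j x) (potentialJet P φ K' j x) t :=
  ((hP.hasDerivAt_potential hφ hK hK' h x).const_mul _).sub (hasDerivAt_traceSum _ φ h0 x)

end IsTransitionSemigroup

end TimeDependentWeights

section EvenPart

theorem mixedDeriv_zero_left (j : ℕ) (F : ℝ → ℝ → ℝ) (t : ℝ) :
    mixedDeriv 0 j F t = iteratedDeriv j (F t) := by
  funext u
  simp only [mixedDeriv, iteratedDeriv_zero]

theorem hasDerivAt_mixedDeriv {F : ℝ → ℝ → ℝ} {i j : ℕ} {t u : ℝ}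
    (h : DifferentiableAt ℝ (fun s => mixedDeriv i j F s u) t) :
    HasDerivAt (fun s => mixedDeriv i j F s u) (mixedDeriv (i + 1) j F t u) t := by
  have hsucc : mixedDeriv (i + 1) j F t u = deriv (fun s => mixedDeriv i j F s u) t := by
    simp only [mixedDeriv, iteratedDeriv_succ]
  rw [hsucc]
  exact h.hasDerivAt

theorem contDiff_evenPart {F : ℝ → ℝ → ℝ} {t : ℝ} {n : WithTop ℕ∞} (hF : ContDiff ℝ n (F t)) :
    ContDiff ℝ n (evenPart F t) :=
  (hF.add (hF.comp contDiff_neg)).div_const 2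

theorem iteratedDeriv_evenPart {F : ℝ → ℝ → ℝ} {j : ℕ} {t : ℝ} (hF : ContDiff ℝ j (F t)) (u : ℝ) :
    iteratedDeriv j (evenPart F t) u =
      (iteratedDeriv j (F t) u + (-1) ^ j * iteratedDeriv j (F t) (-u)) / 2 := by
  have hneg : ContDiff ℝ j fun v => F t (-v) := hF.comp contDiff_neg
  have heven : evenPart F t = fun v => (2⁻¹ : ℝ) * (F t v + F t (-v)) := by
    funext v
    rw [evenPart, div_eq_inv_mul]
  rw [heven, iteratedDeriv_const_mul _ (hF.add hneg).contDiffAt,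
    iteratedDeriv_fun_add hF.contDiffAt hneg.contDiffAt, iteratedDeriv_comp_neg, smul_eq_mul,
    div_eq_inv_mul]

theorem integral_mul_comp_abs {F : ℝ → ℝ → ℝ} {t : ℝ} {G : ℝ → ℝ}
    (hFG : Integrable fun u => F t u * G |u|) :
    ∫ u, F t u * G |u| = 2 * ∫ u in Set.Ioi (0 : ℝ), G u * evenPart F t u := by
  have hreflect : ∫ u, F t (-u) * G |u| = ∫ u, F t u * G |u| := by
    rw [← integral_neg_eq_self (fun u => F t u * G |u|)]
    simp only [abs_neg]
  have hFG' : Integrable fun u => F t (-u) * G |u| := by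
    simpa only [abs_neg] using hFG.comp_neg
  have heven : ∀ u, G |u| * evenPart F t |u| = (F t u * G |u| + F t (-u) * G |u|) / 2 := by
    intro u
    rcases abs_choice u with h | h <;> rw [h, evenPart]
    · ring
    · rw [neg_neg]
      ring
  calc ∫ u, F t u * G |u| = ∫ u, G |u| * evenPart F t |u| := by
        simp only [heven]
        rw [integral_div, integral_add hFG hFG', hreflect, add_self_div_two]
    _ = 2 * ∫ u in Set.Ioi (0 : ℝ), G u * evenPart F t u :=
        integral_comp_abs (f := fun v => G v * evenPart F t v)

end EvenPart

section TimeProcess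

variable {Ω : Type*} [MeasurableSpace Ω] {μ : Measure Ω} {Y : ℝ≥0 → Ω → ℝ} {p : ℝ → ℝ → ℝ}
  {m q r : ℕ} {α : ℕ → ℝ → ℝ} {β : ℕ → ℕ → ℝ → ℝ} {i j : ℕ} {t : ℝ}

namespace TimeProcess

theorem hasDerivAt_evenPart_mixedDeriv (hY : TimeProcess μ Y p m q r α β) (hi : i < q)
    (hj : j ≤ r) (ht : 0 < t) (u : ℝ) :
    HasDerivAt (fun s => (mixedDeriv i j p s u + (-1) ^ j * mixedDeriv i j p s (-u)) / 2)
      ((mixedDeriv (i + 1) j p t u + (-1) ^ j * mixedDeriv (i + 1) j p t (-u)) / 2) t :=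
  ((hasDerivAt_mixedDeriv (hY.differentiable i hi j hj t ht u)).add
    ((hasDerivAt_mixedDeriv (hY.differentiable i hi j hj t ht (-u))).const_mul _)).div_const 2

theorem mixedDeriv_evenPart (hY : TimeProcess μ Y p m q r α β) (hi : i ≤ q) (hj : j ≤ r)
    (ht : 0 < t) (u : ℝ) : mixedDeriv i j (evenPart p) t u =
      (mixedDeriv i j p t u + (-1) ^ j * mixedDeriv i j p t (-u)) / 2 := by
  refine eqOn_iteratedDeriv_of_hasDerivAt isOpen_Ioi
    (G := fun i s => (mixedDeriv i j p s u + (-1) ^ j * mixedDeriv i j p s (-u)) / 2)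
    (fun s hs => ?_) (fun i hi s hs => hY.hasDerivAt_evenPart_mixedDeriv hi hj hs u) hi ht
  simp only [mixedDeriv_zero_left]
  exact iteratedDeriv_evenPart ((hY.contDiff s hs).of_le (by exact_mod_cast hj)) u

theorem mixedDeriv_evenPart_zero_of_odd (hY : TimeProcess μ Y p m q r α β) (hi : i ≤ q)
    (hj : j ≤ r) (ht : 0 < t) (hodd : Odd j) : mixedDeriv i j (evenPart p) t 0 = 0 := by
  rw [hY.mixedDeriv_evenPart hi hj ht, hodd.neg_one_pow, neg_zero, neg_one_mul, add_neg_cancel,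
    zero_div]

theorem mixedDeriv_evenPart_zero_of_even (hY : TimeProcess μ Y p m q r α β) (hi : i ≤ q)
    (hj : j ≤ r) (ht : 0 < t) (heven : Even j) :
    mixedDeriv i j (evenPart p) t 0 = mixedDeriv i j p t 0 := by
  rw [hY.mixedDeriv_evenPart hi hj ht, heven.neg_one_pow, neg_zero, one_mul, add_self_div_two]

theorem hasDerivAt_mixedDeriv_evenPart (hY : TimeProcess μ Y p m q r α β)
    (hij : (i < m ∧ j = 0) ∨ (i < q ∧ j ≤ r)) (ht : 0 < t) (u : ℝ) :
    HasDerivAt (fun s => mixedDeriv i j (evenPart p) s u)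
      (mixedDeriv (i + 1) j (evenPart p) t u) t := by
  refine hasDerivAt_mixedDeriv ?_
  rcases hij with ⟨hi, rfl⟩ | ⟨hi, hj⟩
  · exact hY.differentiable_even i hi t ht u
  · refine (hY.hasDerivAt_evenPart_mixedDeriv hi hj ht u).differentiableAt.congr_of_eventuallyEq ?_
    exact (eventually_gt_nhds ht).mono fun s hs => hY.mixedDeriv_evenPart hi.le hj hs u

theorem hasDerivAt_evenPart_space (hY : TimeProcess μ Y p m q r α β) (hj : j < r) (ht : 0 < t)
    (u : ℝ) : HasDerivAt (mixedDeriv 0 j (evenPart p) t)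
      (mixedDeriv 0 (j + 1) (evenPart p) t u) u := by
  simp only [mixedDeriv_zero_left, iteratedDeriv_succ]
  exact ((contDiff_evenPart (hY.contDiff t ht)).differentiable_iteratedDeriv j
    (by exact_mod_cast hj) u).hasDerivAt

theorem hasL1DerivAt_mixedDeriv_evenPart (hY : TimeProcess μ Y p m q r α β)
    (hij : (i < m ∧ j = 0) ∨ (i < q ∧ j ≤ r)) (ht : 0 < t) :
    HasL1DerivAt volume (mixedDeriv i j (evenPart p)) (mixedDeriv (i + 1) j (evenPart p) t) t :=
  hY.deriv_L1 i j hij t ht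

theorem integrable_mixedDeriv_evenPart_of_density (hY : TimeProcess μ Y p m q r α β) (hi : i ≤ q)
    (hj : j ≤ r) (ht : 0 < t) : Integrable (mixedDeriv i j (evenPart p) t) := by
  have hp : Integrable (mixedDeriv i j p t) := hY.integrable i hi j hj t ht
  rw [funext (hY.mixedDeriv_evenPart hi hj ht)]
  exact (hp.add (hp.comp_neg.const_mul _)).div_const 2

theorem integrable_mixedDeriv_evenPart (hY : TimeProcess μ Y p m q r α β)
    (hij : (i ≤ m ∧ j = 0) ∨ (i ≤ q ∧ j ≤ r)) (ht : 0 < t) :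
    Integrable (mixedDeriv i j (evenPart p) t) := by
  rcases hij with ⟨hi, rfl⟩ | ⟨hi, hj⟩
  · induction i generalizing t with
    | zero => exact hY.integrable_mixedDeriv_evenPart_of_density q.zero_le r.zero_le ht
    | succ i ih =>
      exact (hY.hasL1DerivAt_mixedDeriv_evenPart (Or.inl ⟨hi, rfl⟩) ht).integrable
        ((eventually_gt_nhds ht).mono fun s hs => ih hs (Nat.le_of_succ_le hi))
        (hY.hasDerivAt_mixedDeriv_evenPart (Or.inl ⟨hi, rfl⟩) ht)
  · exact hY.integrable_mixedDeriv_evenPart_of_density hi hj ht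

theorem integral_comp_eq (hY : TimeProcess μ Y p m q r α β) (ht : 0 < t) {F : ℝ → ℝ}
    (hF : Measurable F) : ∫ ω, F (Y t.toNNReal ω) ∂μ = ∫ u, p t u * F u := by
  have hp : Measurable (p t) := (hY.contDiff t ht).continuous.measurable
  rw [← integral_map (hY.measurable _).aemeasurable hF.aestronglyMeasurable, hY.density t ht,
    integral_withDensity_eq_integral_toReal_smul hp.ennreal_ofReal
      (ae_of_all _ fun _ => ENNReal.ofReal_lt_top)]
  simp only [ENNReal.toReal_ofReal (hY.nonneg t ht _), smul_eq_mul]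

end TimeProcess

end TimeProcess

section IteratedMean

variable {Ω E : Type*} [MeasurableSpace Ω] {μ : Measure Ω} [IsProbabilityMeasure μ]
  [TopologicalSpace E] [TopologicalSpace.PseudoMetrizableSpace E] [MeasurableSpace E]
  [BorelSpace E] {U : E → ℝ≥0 → Ω → E} {Y : ℝ≥0 → Ω → ℝ} {g : E → ℝ} {t : ℝ}

theorem IsDiffusion.iteratedMean_eq_integral_semigroup (hU : IsDiffusion μ U)
    (hYm : Measurable (Y t.toNNReal)) {x : E}
    (hUY : IndepFun (fun ω t => U x t ω) (Y t.toNNReal) μ) (hg : g ∈ boundedFunctions E) :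
    iteratedMean μ U Y g t x =
      ∫ ω, semigroup μ U |Y t.toNNReal ω|.toNNReal g x ∂μ := by
  have hnnabs : Measurable fun u : ℝ => |u|.toNNReal :=
    measurable_real_toNNReal.comp measurable_abs
  simp only [iteratedMean, ← Real.toNNReal_abs]
  exact integral_eval_indep_time (hU.measurable x) (hU.ae_continuous x) (hnnabs.comp hYm)
    (hUY.comp measurable_id hnnabs) hg

theorem TimeProcess.iteratedMean_eq_potential {p : ℝ → ℝ → ℝ} {m q r : ℕ} {α : ℕ → ℝ → ℝ}
    {β : ℕ → ℕ → ℝ → ℝ} (hY : TimeProcess μ Y p m q r α β) (hU : IsDiffusion μ U)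
    (hUY : ∀ x, IndepFun (fun ω t => U x t ω) (fun ω t => Y t ω) μ)
    (hg : g ∈ strongSpace (semigroup μ U)) (ht : 0 < t) :
    iteratedMean μ U Y g t = (2 : ℝ) • potential (semigroup μ U) g (evenPart p t) := by
  obtain ⟨κ, hP⟩ := hU.exists_isTransitionSemigroup
  obtain ⟨C, hC⟩ := hg.1.2
  funext x
  have hc : Continuous fun u : ℝ => semigroup μ U |u|.toNNReal g x :=
    (hP.continuous_apply_toNNReal hg x).comp continuous_abs
  have hp : Integrable (p t) := by
    simpa only [mixedDeriv_zero_left, iteratedDeriv_zero] using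
      hY.integrable 0 q.zero_le 0 r.zero_le t ht
  rw [hU.iteratedMean_eq_integral_semigroup (hY.measurable _)
      ((hUY x).comp measurable_id (measurable_pi_apply t.toNNReal)) hg.1,
    hY.integral_comp_eq ht hc.measurable,
    integral_mul_comp_abs (G := fun u => semigroup μ U u.toNNReal g x) (hp.mul_bdd (c := C)
      hc.aestronglyMeasurable (ae_of_all _ fun u => hP.abs_apply_le _ hg.1.1 hC x))]
  rfl

end IteratedMean

section MeanJet

variable {E : Type*} {A : (E → ℝ) → E → ℝ} {φ : E → ℝ} {j : ℕ}

theorem sum_range_eq_sum_even {a : ℕ → ℝ} (ha : ∀ l < j, Odd l → a l = 0) :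
    ∑ k ∈ (Finset.range j).filter (fun k => 2 * k ≤ j - 1), a (2 * k) =
      ∑ l ∈ Finset.range j, a l := by
  refine Finset.sum_of_injOn (fun k => 2 * k) (fun k _ l _ h => ?_) (fun k hk => ?_)
    (fun l hl hl' => ha l (Finset.mem_range.1 hl) ?_) fun k _ => rfl
  · simpa using h
  · simp only [Finset.coe_filter, Finset.mem_range, Set.mem_ofPred_eq, Finset.coe_range,
      Set.mem_Iio] at *
    omega
  · by_contra hodd
    obtain ⟨k, rfl⟩ := even_iff_exists_two_mul.1 (Nat.not_odd_iff_even.1 hodd)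
    refine hl' ⟨k, ?_, rfl⟩
    simp only [Finset.coe_filter, Finset.mem_range, Set.mem_ofPred_eq] at *
    omega

theorem neg_one_pow_mul_traceSum {a : ℕ → ℝ} (ha : ∀ l < j, Odd l → a l = 0) (x : E) :
    (-1) ^ j * traceSum A φ a j x =
      ∑ k ∈ (Finset.range j).filter (fun k => 2 * k ≤ j - 1),
        (-1) ^ (j - 2 * k) * A^[j - 1 - 2 * k] φ x * a (2 * k) := by
  have heven := sum_range_eq_sum_even (j := j) (a := fun l => (-1) ^ l * a l * A^[j - 1 - l] φ x)
    fun l hl hodd => by rw [ha l hl hodd, mul_zero, zero_mul]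
  simp only [traceSum, Finset.sum_apply, Pi.smul_apply, smul_eq_mul]
  rw [← heven, Finset.mul_sum]
  refine Finset.sum_congr rfl fun k hk => ?_
  have hk : 2 * k ≤ j := (Finset.mem_filter.1 hk).2.trans (Nat.sub_le j 1)
  have hpow : (-1 : ℝ) ^ (j - 2 * k) = (-1) ^ j := by
    rw [← Nat.sub_add_cancel hk, Nat.add_sub_cancel, pow_add, (even_two_mul k).neg_one_pow, mul_one]
  rw [hpow, (even_two_mul k).neg_one_pow]
  ring

variable {Ω : Type*} [MeasurableSpace Ω] {μ : Measure Ω} {Y : ℝ≥0 → Ω → ℝ} {p : ℝ → ℝ → ℝ}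
  {m q r : ℕ} {α : ℕ → ℝ → ℝ} {β : ℕ → ℕ → ℝ → ℝ} {i : ℕ} {t : ℝ}

theorem TimeProcess.boundaryTerm_eq (hY : TimeProcess μ Y p m q r α β) (ht : 0 < t) (x : E) :
    boundaryTerm A p q r β φ t x =
      2 * ∑ i ∈ Finset.range (q + 1), ∑ j ∈ Finset.Icc 1 r, β i j t *
        ((-1) ^ j * traceSum A φ (fun l => mixedDeriv i l (evenPart p) t 0) j x) := by
  rw [boundaryTerm]
  congr 1
  refine Finset.sum_congr rfl fun i hi => Finset.sum_congr rfl fun j hj => congrArg _ ?_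
  have hi : i ≤ q := Nat.lt_succ_iff.1 (Finset.mem_range.1 hi)
  have hj : j ≤ r := (Finset.mem_Icc.1 hj).2
  rw [neg_one_pow_mul_traceSum fun l hl =>
    hY.mixedDeriv_evenPart_zero_of_odd hi (hl.le.trans hj) ht]
  refine Finset.sum_congr rfl fun k hk => ?_
  have hk : 2 * k ≤ r := ((Finset.mem_filter.1 hk).2.trans (Nat.sub_le j 1)).trans hj
  rw [hY.mixedDeriv_evenPart_zero_of_even hi hk ht (even_two_mul k)]

/-- The closed form of `∂_t^i 𝓛^j h(t, ·)` for the mean `h(t, ·) = 2 ∫₀^∞ P_u φ E(p)(t, u) du`. -/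
def meanJet (P : ℝ≥0 → (E → ℝ) → E → ℝ) (φ : E → ℝ) (p : ℝ → ℝ → ℝ) (i j : ℕ) (t : ℝ) : E → ℝ :=
  (2 : ℝ) • potentialJet P φ (fun l => mixedDeriv i l (evenPart p) t) j

theorem meanJet_zero (P : ℝ≥0 → (E → ℝ) → E → ℝ) (φ : E → ℝ) (p : ℝ → ℝ → ℝ) (i : ℕ) (t : ℝ) :
    meanJet P φ p i 0 t = (2 : ℝ) • potential P φ (mixedDeriv i 0 (evenPart p) t) := by
  rw [meanJet, potentialJet_zero]

theorem meanJet_apply (P : ℝ≥0 → (E → ℝ) → E → ℝ) (φ : E → ℝ) (p : ℝ → ℝ → ℝ) (i j : ℕ) (t : ℝ)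
    (x : E) : meanJet P φ p i j t x =
      2 * ((-1) ^ j * potential P φ (mixedDeriv i j (evenPart p) t) x -
        traceSum (generator P) φ (fun l => mixedDeriv i l (evenPart p) t 0) j x) :=
  rfl

namespace TimeProcess

variable [MeasurableSpace E] {κ : ℝ≥0 → Kernel E E} {P : ℝ≥0 → (E → ℝ) → E → ℝ}

theorem meanJet_mem_strongSpace (hY : TimeProcess μ Y p m q r α β) (hP : IsTransitionSemigroup κ P)
    (hφ : φ ∈ strongSpace P) (ht : 0 < t) : meanJet P φ p 0 0 t ∈ strongSpace P := by
  rw [meanJet_zero]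
  exact hP.const_smul_mem_strongSpace _ (hP.potential_mem_strongSpace hφ
    (hY.integrable_mixedDeriv_evenPart (Or.inr ⟨q.zero_le, r.zero_le⟩) ht).integrableOn)

theorem hasGenerator_meanJet (hY : TimeProcess μ Y p m q r α β) (hP : IsTransitionSemigroup κ P)
    (hφ : φ ∈ iterDomain P (r - 1)) (ht : 0 < t) (hj : j < r) :
    HasGenerator P (meanJet P φ p 0 j t) (meanJet P φ p 0 (j + 1) t) :=
  HasGenerator.const_smul hP 2 <| hP.hasGenerator_potentialJet hφ
    (fun _ hl u => hY.hasDerivAt_evenPart_space hl ht u)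
    (fun _ hl => (hY.integrable_mixedDeriv_evenPart (Or.inr ⟨q.zero_le, hl⟩) ht).integrableOn) hj

theorem meanJet_mem_iterDomain (hY : TimeProcess μ Y p m q r α β) (hP : IsTransitionSemigroup κ P)
    (hφ : φ ∈ iterDomain P (r - 1)) (ht : 0 < t) {n : ℕ} (hn : n ≤ r) :
    meanJet P φ p 0 0 t ∈ iterDomain P n :=
  mem_iterDomain_of_hasGenerator (Φ := fun j => meanJet P φ p 0 j t)
    (hY.meanJet_mem_strongSpace hP (mem_iterDomain_iff.1 hφ).1 ht)
    fun _ hj => hY.hasGenerator_meanJet hP hφ ht (hj.trans_le hn)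

theorem iterate_generator_meanJet (hY : TimeProcess μ Y p m q r α β)
    (hP : IsTransitionSemigroup κ P) (hφ : φ ∈ iterDomain P (r - 1)) (ht : 0 < t) (hj : j ≤ r) :
    (generator P)^[j] (meanJet P φ p 0 0 t) = meanJet P φ p 0 j t :=
  iterate_generator_eq (Φ := fun j => meanJet P φ p 0 j t)
    (fun _ hl => hY.hasGenerator_meanJet hP hφ ht hl) hj

theorem hasDerivAt_meanJet (hY : TimeProcess μ Y p m q r α β) (hP : IsTransitionSemigroup κ P)
    (hφ : φ ∈ strongSpace P) (hij : (i < m ∧ j = 0) ∨ (i < q ∧ j ≤ r)) (ht : 0 < t) (x : E) :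
    HasDerivAt (fun s => meanJet P φ p i j s x) (meanJet P φ p (i + 1) j t x) t := by
  have hint : ∀ s > 0, IntegrableOn (mixedDeriv i j (evenPart p) s) (Set.Ioi 0) := fun s hs =>
    (hY.integrable_mixedDeriv_evenPart (hij.imp (.imp_left le_of_lt) (.imp_left le_of_lt))
      hs).integrableOn
  have htrace : ∀ l < j, HasDerivAt (fun s => mixedDeriv i l (evenPart p) s 0)
      (mixedDeriv (i + 1) l (evenPart p) t 0) t := fun l hl =>
    hY.hasDerivAt_mixedDeriv_evenPart (Or.inr (by omega)) ht 0
  have hjet := hP.hasDerivAt_potentialJet hφ (K := fun s l => mixedDeriv i l (evenPart p) s)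
    (K' := fun l => mixedDeriv (i + 1) l (evenPart p) t) ((eventually_gt_nhds ht).mono hint)
    (hY.integrable_mixedDeriv_evenPart hij ht).integrableOn
    ((hY.hasL1DerivAt_mixedDeriv_evenPart hij ht).restrict _) htrace x
  exact hjet.const_mul 2

theorem sum_mul_potential_eq (hY : TimeProcess μ Y p m q r α β) (hP : IsTransitionSemigroup κ P)
    (hφ : φ ∈ strongSpace P) (ht : 0 < t) (x : E) :
    ∑ k ∈ Finset.Icc 1 m, α k t * potential P φ (mixedDeriv k 0 (evenPart p) t) x =
      ∑ i ∈ Finset.range (q + 1), ∑ j ∈ Finset.Icc 1 r,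
        β i j t * potential P φ (mixedDeriv i j (evenPart p) t) x := by
  have htime : ∀ k ∈ Finset.Icc 1 m,
      IntegrableOn (mixedDeriv k 0 (evenPart p) t) (Set.Ioi 0) := fun k hk =>
    (hY.integrable_mixedDeriv_evenPart (Or.inl ⟨(Finset.mem_Icc.1 hk).2, rfl⟩) ht).integrableOn
  have hspace : ∀ z ∈ Finset.range (q + 1) ×ˢ Finset.Icc 1 r,
      IntegrableOn (mixedDeriv z.1 z.2 (evenPart p) t) (Set.Ioi 0) := fun z hz => by
    obtain ⟨hi, hj⟩ := Finset.mem_product.1 hz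
    exact (hY.integrable_mixedDeriv_evenPart (Or.inr ⟨Nat.lt_succ_iff.1 (Finset.mem_range.1 hi),
      (Finset.mem_Icc.1 hj).2⟩) ht).integrableOn
  rw [← hP.potential_sum_mul hφ htime, funext (hY.equation t ht), ← Finset.sum_product',
    ← hP.potential_sum_mul hφ hspace]
  simp only [Finset.sum_product]

theorem sum_mul_meanJet_eq (hY : TimeProcess μ Y p m q r α β) (hP : IsTransitionSemigroup κ P)
    (hφ : φ ∈ strongSpace P) (ht : 0 < t) (x : E) :
    ∑ k ∈ Finset.Icc 1 m, α k t * meanJet P φ p k 0 t x =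
      ∑ i ∈ Finset.range (q + 1), ∑ j ∈ Finset.Icc 1 r,
        β i j t * (-1) ^ j * meanJet P φ p i j t x
      + boundaryTerm (generator P) p q r β φ t x := by
  calc ∑ k ∈ Finset.Icc 1 m, α k t * meanJet P φ p k 0 t x
      = 2 * ∑ k ∈ Finset.Icc 1 m, α k t * potential P φ (mixedDeriv k 0 (evenPart p) t) x := by
        simp only [meanJet_zero, Pi.smul_apply, smul_eq_mul, Finset.mul_sum, mul_left_comm]
    _ = 2 * ∑ i ∈ Finset.range (q + 1), ∑ j ∈ Finset.Icc 1 r,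
          β i j t * potential P φ (mixedDeriv i j (evenPart p) t) x := by
        rw [hY.sum_mul_potential_eq hP hφ ht]
    _ = _ := by
        rw [hY.boundaryTerm_eq ht]
        simp only [Finset.mul_sum, ← Finset.sum_add_distrib]
        refine Finset.sum_congr rfl fun i _ => Finset.sum_congr rfl fun j _ => ?_
        have hsq : ((-1 : ℝ) ^ j) * (-1) ^ j = 1 := by rw [← mul_pow, neg_one_mul, neg_neg, one_pow]
        rw [meanJet_apply]
        linear_combination (-2 * β i j t * potential P φ (mixedDeriv i j (evenPart p) t) x) * hsq

end TimeProcess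

end MeanJet

section IteratedMeanPowers

variable {Ω E : Type*} [MeasurableSpace Ω] {μ : Measure Ω} [IsProbabilityMeasure μ]
  [TopologicalSpace E] [TopologicalSpace.PseudoMetrizableSpace E] [MeasurableSpace E]
  [BorelSpace E] {U : E → ℝ≥0 → Ω → E} {Y : ℝ≥0 → Ω → ℝ} {p : ℝ → ℝ → ℝ} {m q r : ℕ}
  {α : ℕ → ℝ → ℝ} {β : ℕ → ℕ → ℝ → ℝ} {g : E → ℝ} {i j : ℕ} {t : ℝ}

namespace TimeProcess

theorem iteratedMean_eq_meanJet (hY : TimeProcess μ Y p m q r α β) (hU : IsDiffusion μ U)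
    (hUY : ∀ x, IndepFun (fun ω t => U x t ω) (fun ω t => Y t ω) μ)
    (hg : g ∈ strongSpace (semigroup μ U)) (ht : 0 < t) :
    iteratedMean μ U Y g t = meanJet (semigroup μ U) g p 0 0 t := by
  rw [hY.iteratedMean_eq_potential hU hUY hg ht, meanJet_zero, mixedDeriv_zero_left,
    iteratedDeriv_zero]

theorem eqOn_iterate_generator_iteratedMean (hY : TimeProcess μ Y p m q r α β)
    (hU : IsDiffusion μ U) (hUY : ∀ x, IndepFun (fun ω t => U x t ω) (fun ω t => Y t ω) μ)
    (hg : g ∈ iterDomain (semigroup μ U) (r - 1)) (hj : j ≤ r) (x : E) :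
    Set.EqOn (fun s => (generator (semigroup μ U))^[j] (iteratedMean μ U Y g s) x)
      (fun s => meanJet (semigroup μ U) g p 0 j s x) (Set.Ioi 0) := by
  obtain ⟨κ, hP⟩ := hU.exists_isTransitionSemigroup
  intro s hs
  simp only
  rw [hY.iteratedMean_eq_meanJet hU hUY (mem_iterDomain_iff.1 hg).1 hs,
    hY.iterate_generator_meanJet hP hg hs hj]

theorem iteratedDeriv_iteratedMean (hY : TimeProcess μ Y p m q r α β) (hU : IsDiffusion μ U)
    (hUY : ∀ x, IndepFun (fun ω t => U x t ω) (fun ω t => Y t ω) μ)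
    (hg : g ∈ iterDomain (semigroup μ U) (r - 1)) (hij : (i ≤ m ∧ j = 0) ∨ (i ≤ q ∧ j ≤ r))
    (ht : 0 < t) (x : E) :
    iteratedDeriv i (fun s => (generator (semigroup μ U))^[j] (iteratedMean μ U Y g s) x) t =
      meanJet (semigroup μ U) g p i j t x := by
  obtain ⟨κ, hP⟩ := hU.exists_isTransitionSemigroup
  exact eqOn_iteratedDeriv_of_hasDerivAt isOpen_Ioi
    (G := fun l s => meanJet (semigroup μ U) g p l j s x)
    (hY.eqOn_iterate_generator_iteratedMean hU hUY hg (by omega) x)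
    (fun l hl s hs => hY.hasDerivAt_meanJet hP (mem_iterDomain_iff.1 hg).1
      (hij.imp (.imp_left hl.trans_le) (.imp_left hl.trans_le)) hs x) le_rfl ht

theorem differentiableAt_iteratedDeriv_iteratedMean (hY : TimeProcess μ Y p m q r α β)
    (hU : IsDiffusion μ U) (hUY : ∀ x, IndepFun (fun ω t => U x t ω) (fun ω t => Y t ω) μ)
    (hg : g ∈ iterDomain (semigroup μ U) (r - 1)) (hij : (i < m ∧ j = 0) ∨ (i < q ∧ j ≤ r))
    (ht : 0 < t) (x : E) :
    DifferentiableAt ℝ (iteratedDeriv i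
      fun s => (generator (semigroup μ U))^[j] (iteratedMean μ U Y g s) x) t := by
  obtain ⟨κ, hP⟩ := hU.exists_isTransitionSemigroup
  have hjet : HasDerivAt (fun s => meanJet (semigroup μ U) g p i j s x) _ t :=
    hY.hasDerivAt_meanJet hP (mem_iterDomain_iff.1 hg).1 hij ht x
  refine hjet.differentiableAt.congr_of_eventuallyEq ((eventually_gt_nhds ht).mono fun s hs => ?_)
  exact hY.iteratedDeriv_iteratedMean hU hUY hg
    (hij.imp (.imp_left le_of_lt) (.imp_left le_of_lt)) hs x

end TimeProcess

end IteratedMeanPowers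

end IteratedProcess

end

theorem mainTheorem7_general {Ω E : Type*} [MeasurableSpace Ω] (μ : Measure Ω)
    [IsProbabilityMeasure μ] [TopologicalSpace E] [TopologicalSpace.PseudoMetrizableSpace E]
    [MeasurableSpace E] [BorelSpace E] (U : E → ℝ≥0 → Ω → E) (hU : IsDiffusion μ U)
    (Y : ℝ≥0 → Ω → ℝ) (p : ℝ → ℝ → ℝ) (m q r : ℕ) (α : ℕ → ℝ → ℝ) (β : ℕ → ℕ → ℝ → ℝ)
    (hY : TimeProcess μ Y p m q r α β)
    (hUY : ∀ x, IndepFun (fun ω t => U x t ω) (fun ω t => Y t ω) μ)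
    (g : E → ℝ) (hg : g ∈ iterDomain (semigroup μ U) (r - 1))
    (h : ℝ → E → ℝ) (hh : h = iteratedMean μ U Y g) :
    (∀ t ≥ 0, h t ∈ iterDomain (semigroup μ U) (r - 1)) ∧
    (∀ t > 0, h t ∈ iterDomain (semigroup μ U) r) ∧
    (∀ x, ∀ k < m, ∀ t > 0, DifferentiableAt ℝ (iteratedDeriv k fun s => h s x) t) ∧
    (∀ x, ∀ i < q, ∀ j ≤ r, ∀ t > 0,
      DifferentiableAt ℝ (iteratedDeriv i fun s => (generator (semigroup μ U))^[j] (h s) x) t) ∧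
    (∀ t > 0, ∀ x,
      ∑ k ∈ Finset.Icc 1 m, α k t * iteratedDeriv k (fun s => h s x) t =
        ∑ i ∈ Finset.range (q + 1), ∑ j ∈ Finset.Icc 1 r, β i j t * (-1) ^ j *
          iteratedDeriv i (fun s => (generator (semigroup μ U))^[j] (h s) x) t
        + boundaryTerm (generator (semigroup μ U)) p q r β g t x) ∧
    (∀ x, h 0 x = g x) := by
  subst hh
  obtain ⟨κ, hP⟩ := hU.exists_isTransitionSemigroup
  have hgs : g ∈ strongSpace (semigroup μ U) := (mem_iterDomain_iff.1 hg).1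
  have hstart : iteratedMean μ U Y g 0 = g := hU.iteratedMean_zero hY.start g
  have hdom : ∀ n ≤ r, ∀ t > 0, iteratedMean μ U Y g t ∈ iterDomain (semigroup μ U) n :=
    fun n hn t ht => by
      rw [hY.iteratedMean_eq_meanJet hU hUY hgs ht]
      exact hY.meanJet_mem_iterDomain hP hg ht hn
  refine ⟨fun t ht => ?_, hdom r le_rfl,
    fun x k hk t ht => hY.differentiableAt_iteratedDeriv_iteratedMean hU hUY hg
      (Or.inl ⟨hk, rfl⟩) ht x,
    fun x i hi j hj t ht => hY.differentiableAt_iteratedDeriv_iteratedMean hU hUY hg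
      (Or.inr ⟨hi, hj⟩) ht x,
    fun t ht x => ?_, congrFun hstart⟩
  · rcases ht.eq_or_lt with rfl | ht
    · rwa [hstart]
    · exact hdom (r - 1) (r.sub_le 1) t ht
  · convert hY.sum_mul_meanJet_eq hP hgs ht x using 1
    · exact Finset.sum_congr rfl fun k hk => congrArg _ <|
        hY.iteratedDeriv_iteratedMean hU hUY hg (Or.inl ⟨(Finset.mem_Icc.1 hk).2, rfl⟩) ht x
    · exact congrArg (· + _) <| Finset.sum_congr rfl fun i hi => Finset.sum_congr rfl fun j hj =>
        congrArg _ <| hY.iteratedDeriv_iteratedMean hU hUY hg (Or.inr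
          ⟨Nat.lt_succ_iff.1 (Finset.mem_range.1 hi), (Finset.mem_Icc.1 hj).2⟩) ht x

theorem mainTheorem7 {Ω : Type*} [MeasurableSpace Ω] (μ : Measure Ω) [IsProbabilityMeasure μ]
    (d n : ℕ)
    (X : EuclideanSpace ℝ (Fin d) → ℝ≥0 → Ω → EuclideanSpace ℝ (Fin d))
    (U : EuclideanSpace ℝ (Fin n) → ℝ≥0 → Ω → EuclideanSpace ℝ (Fin n))
    (hX : IsDiffusion μ X) (hU : IsDiffusion μ U)
    (Y : ℝ≥0 → Ω → ℝ) (p : ℝ → ℝ → ℝ) (m q r : ℕ) (hr : 1 ≤ r)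
    (α : ℕ → ℝ → ℝ) (β : ℕ → ℕ → ℝ → ℝ)
    (hY : TimeProcess μ Y p m q r α β)
    (hXY : ∀ x, IndepFun (fun ω t => X x t ω) (fun ω t => Y t ω) μ)
    (hUY : ∀ x, IndepFun (fun ω t => U x t ω) (fun ω t => Y t ω) μ)
    (Λ : EuclideanSpace ℝ (Fin n) → EuclideanSpace ℝ (Fin d) → ℝ)
    (hΛ : IsIntertwining (semigroup μ X) (semigroup μ U) Λ)
    (f : EuclideanSpace ℝ (Fin d) → ℝ) (hf : f ∈ iterDomain (semigroup μ X) (r - 1))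
    (g : EuclideanSpace ℝ (Fin n) → ℝ) (hg : g = kernelOp Λ f)
    (h : ℝ → EuclideanSpace ℝ (Fin n) → ℝ) (hh : h = iteratedMean μ U Y g) :
    -- domains: `h(t, ·) ∈ D(𝓛_U^{r-1})`, and the powers `𝓛_U^j h`, `j ≤ r`, of the equation exist
    (∀ t ≥ 0, h t ∈ iterDomain (semigroup μ U) (r - 1)) ∧
    (∀ t > 0, h t ∈ iterDomain (semigroup μ U) r) ∧
    -- the time derivatives in the equation exist
    (∀ x, ∀ k < m, ∀ t > 0, DifferentiableAt ℝ (iteratedDeriv k fun s => h s x) t) ∧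
    (∀ x, ∀ i < q, ∀ j ≤ r, ∀ t > 0,
      DifferentiableAt ℝ (iteratedDeriv i fun s => (generator (semigroup μ U))^[j] (h s) x) t) ∧
    -- the equation
    (∀ t > 0, ∀ x,
      ∑ k ∈ Finset.Icc 1 m, α k t * iteratedDeriv k (fun s => h s x) t =
        ∑ i ∈ Finset.range (q + 1), ∑ j ∈ Finset.Icc 1 r, β i j t * (-1) ^ j *
          iteratedDeriv i (fun s => (generator (semigroup μ U))^[j] (h s) x) t
        + boundaryTerm (generator (semigroup μ U)) p q r β g t x) ∧
    -- the initial condition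
    (∀ x, h 0 x = g x) := by
  obtain ⟨κ, hPX⟩ := hX.exists_isTransitionSemigroup
  exact mainTheorem7_general μ U hU Y p m q r α β hY hUY g
    (hg ▸ hΛ.kernelOp_mem_iterDomain hPX hf) h hh
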